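/- Let $G=(V,E)$ be a finite connected graph and $c:E\to\mathbb{R}_+$. For $T\subseteq V$ with $|T|$ even, a $T$-join is a set $F\subseteq E$ such that $T$ is the set $T_F$ of vertices incident to an odd number of edges of $F$ (with multiplicities, if $F$ is a multiset); $\tau(G,T,c)$ is the minimum length of a $T$-join. A $T$-tour is a multiset of edges of $G$, each with multiplicity at most $2$, that is a $T$-join (counted with multiplicities) and forms a connected multigraph on $V$. Let $$P(G,T)=\{x\in\mathbb{R}^E:\ x(\delta(W))\ge 2 \text{ for } \emptyset\ne W\subsetneq V,\ |W\cap T| \text{ even};\ \ x(\delta(\mathcal W))\ge|\mathcal W|-1 \text{ for all partitions } \mathcal W \text{ of } V;\ \ 0\le x\le 2\},$$ where $\delta(W)$ is the set of edges with exactly one endpoint in $W$ and $\delta(\mathcal W)$ the set of edges joining different classes of $\mathcal W$. Let $x^*$ minimize $c^\top x$ on $P(G,T)$. (a) Let $\mathcal F$ be a random spanning tree of $G$ with $\Pr(\mathcal F=F)=\lambda_F$, where the $\lambda_F\ge 0$, summing to $1$, satisfy $\sum_F\lambda_F\chi_F\le x^*$. Then $$E[\tau(G,T_{\mathcal F}\triangle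 T,c)]\le\tfrac35\,c^\top x^*.$$ (b) Consider the Best-of-Many Christofides algorithm: choose $x^*$ and $\lambda$ as above, for every $F$ with $\lambda_F>0$ a shortest $T_F\triangle T$-join $J_F$, and output an $F+J_F$ (multiset sum) of minimum length. Such choices always exist, and every possible output is a $T$-tour of length at most $\frac85c^\top x^*$ and at most $\frac85$ times the minimum length of a $T$-tour. (c) In particular, for $s,t\in V$ and $T=\{s\}\triangle\{t\}$, every possible output is the edge multiset of a walk from $s$ to $t$ that visits all vertices and has length at most $\frac85$ times the length of any such walk. If moreover $G$ is complete, $c$ satisfies the triangle inequality and $s\ne t$, then this walk can be shortcut to a Hamiltonian path from $s$ to $t$ of length at most $\frac85$ times that of a shortest Hamiltonian path from $s$ to $t$. -/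

import Mathlib

namespace TTour

variable {V : Type*} [Fintype V] [DecidableEq V] (G : SimpleGraph V) [DecidableRel G.Adj]

/-- The cut `δ(X)`: the edges with exactly one endpoint in `X`. -/
def cut (X : Finset V) : Finset G.edgeSet :=
  Finset.univ.filter fun e => ∃ u ∈ X, ∃ v, v ∉ X ∧ (e : Sym2 V) = s(u, v)

/-- `δ(𝒲)`: the edges whose two endpoints lie in different classes of the partition `𝒲`. -/
def multicut (W : Finpartition (Finset.univ : Finset V)) : Finset G.edgeSet :=
  W.parts.biUnion fun X => cut G X

/-- The polytope `P(G, T)`. -/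
def P (T : Finset V) : Set (G.edgeSet → ℝ) :=
  {x | (∀ W : Finset V, W.Nonempty → W ≠ Finset.univ → Even (W ∩ T).card →
          2 ≤ ∑ e ∈ cut G W, x e) ∧
       (∀ W : Finpartition (Finset.univ : Finset V),
          (W.parts.card : ℝ) - 1 ≤ ∑ e ∈ multicut G W, x e) ∧
       ∀ e, 0 ≤ x e ∧ x e ≤ 2}

variable {G} in
/-- The scalar product `cᵀx`. -/
def dot (c x : G.edgeSet → ℝ) : ℝ := ∑ e, c e * x e

variable {G} in
/-- The length of a multiset of edges, given by its multiplicities. -/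
def multiLength (c : G.edgeSet → ℝ) (H : G.edgeSet → ℕ) : ℝ := ∑ e, c e * (H e : ℝ)

/-- `x` is an optimal solution of `min {cᵀx : x ∈ P(G, T)}`. -/
def IsOptimal (T : Finset V) (c x : G.edgeSet → ℝ) : Prop :=
  x ∈ P G T ∧ ∀ y ∈ P G T, dot c x ≤ dot c y

/-- `T_F`: the vertices incident to an odd number of edges of `F`. -/
def oddVerts (F : Finset G.edgeSet) : Finset V :=
  Finset.univ.filter fun v => Odd (cut G {v} ∩ F).card

/-- `F` is a `T`-join of `G`. -/
def IsTJoin (T : Finset V) (F : Finset G.edgeSet) : Prop := oddVerts G F = T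

/-- `J` is a shortest `T`-join of `G`. -/
def IsShortestTJoin (T : Finset V) (c : G.edgeSet → ℝ) (J : Finset G.edgeSet) : Prop :=
  IsTJoin G T J ∧ ∀ J', IsTJoin G T J' → ∑ e ∈ J, c e ≤ ∑ e ∈ J', c e

/-- `τ(G, T, c)`: the minimum length of a `T`-join (the infimum is over a finite set, which is
nonempty whenever `G` is connected and `|T|` is even). -/
noncomputable def tau (T : Finset V) (c : G.edgeSet → ℝ) : ℝ :=
  sInf {r | ∃ J, IsTJoin G T J ∧ r = ∑ e ∈ J, c e}

/-- `F` is (the edge set of) a spanning tree of `G`. -/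
def IsSpanningTree (F : Finset G.edgeSet) : Prop :=
  (SimpleGraph.fromEdgeSet {a : Sym2 V | ∃ e ∈ F, (e : Sym2 V) = a}).IsTree

/-- `lam` is the distribution of a random spanning tree of `G` (the coefficients of a convex
combination of spanning trees) such that `∑ F, lam F • χ_F ≤ x`. -/
structure IsTreeDistribution (x : G.edgeSet → ℝ) (lam : Finset G.edgeSet → ℝ) : Prop where
  nonneg : ∀ F, 0 ≤ lam F
  isSpanningTree : ∀ F, 0 < lam F → IsSpanningTree G F
  sum_eq_one : ∑ F, lam F = 1
  dominated : ∀ e, ∑ F, lam F * (if e ∈ F then 1 else 0) ≤ x e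

variable {G} in
/-- The expectation of `f 𝓕`, where `Pr (𝓕 = F) = lam F`. -/
def expectation (lam f : Finset G.edgeSet → ℝ) : ℝ := ∑ F, lam F * f F

/-- `H` is a `T`-tour: a sub-multiset of `2E` that is a `T`-join of `2G` and for which `(V, H)` is
a connected multigraph. -/
structure IsTTour (T : Finset V) (H : G.edgeSet → ℕ) : Prop where
  le_two : ∀ e, H e ≤ 2
  parity : ∀ v, v ∈ T ↔ Odd (∑ e ∈ cut G {v}, H e)
  connected : (SimpleGraph.fromEdgeSet {a : Sym2 V | ∃ e, H e ≠ 0 ∧ (e : Sym2 V) = a}).Connected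

variable {G} in
/-- The multiset sum `A + B` of two sets of edges. -/
def multiAdd (A B : Finset G.edgeSet) : G.edgeSet → ℕ :=
  fun e => (if e ∈ A then 1 else 0) + (if e ∈ B then 1 else 0)

/-- `H` is a possible output of the Best of Many Christofides algorithm on `(G, T, c)`: take an
optimal `x` in `P(G, T)`, a convex combination `lam` of spanning trees dominated by `x`, a shortest
`T_F ∆ T`-join `J F` for each tree `F` of the combination, and let `H` be a shortest one of the
multisets `F + J F`. -/
def IsBestOfManyOutput (T : Finset V) (c : G.edgeSet → ℝ) (H : G.edgeSet → ℕ) : Prop :=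
  ∃ (x : G.edgeSet → ℝ) (lam : Finset G.edgeSet → ℝ) (J : Finset G.edgeSet → Finset G.edgeSet),
    IsOptimal G T c x ∧ IsTreeDistribution G x lam ∧
    (∀ F, 0 < lam F → IsShortestTJoin G (symmDiff (oddVerts G F) T) c (J F)) ∧
    ∃ F, 0 < lam F ∧ H = multiAdd F (J F) ∧
      ∀ F', 0 < lam F' → multiLength c H ≤ multiLength c (multiAdd F' (J F'))

variable {G} in
/-- The number of times that the walk `w` uses each edge. -/
def walkMult {s t : V} (w : G.Walk s t) : G.edgeSet → ℕ := fun e => w.edges.count (e : Sym2 V)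

variable {G} in
/-- `c` satisfies the triangle inequality (on the triangles of `G`). -/
def TriangleInequality (c : G.edgeSet → ℝ) : Prop :=
  ∀ (u v w : V) (huv : G.Adj u v) (hvw : G.Adj v w) (huw : G.Adj u w),
    c ⟨s(u, w), huw⟩ ≤ c ⟨s(u, v), huv⟩ + c ⟨s(v, w), hvw⟩

end TTour

set_option linter.unusedSectionVars false

namespace TTour

variable {V : Type*} [Fintype V] [DecidableEq V] {G : SimpleGraph V} [DecidableRel G.Adj]

/-! ## Cuts, parities and joins -/

/-! For a tree `F` let `X F` be the `T`-join inside `F`. The rest `F \ X F` is one `T_F ∆ T`-join. A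
second bound comes from Edmonds–Johnson (`exists_tjoin_le_dot`): any nonnegative vector that is at
least 1 on all cuts odd for `T_F ∆ T` costs at least as much as some such join.

The vector 1/9 χ_F + 4/9 x is large enough on cuts of value at least 2. A narrow cut `Q`, of value z
< 2, is odd for `T`, so it can be deficient only if it meets `F` evenly, hence at least twice; the
deficit is then at most (7 - 4z)/9. It is repaired by a multiple of the vector e ↦ Pr(Q ∩ 𝓕 = {e}),
which has mass at least 2 - z on `Q`, because E|Q ∩ 𝓕| ≤ z while every tree meets `Q`. For the same
reason the repair is needed with probability at most z - 1, and (z - 1)(7 - 4z) ≤ 2 - z is a perfect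
square inequality, so the expected multiple is at most 1/9.

If Q ∩ F = {e} with `Q` narrow, then e ∈ X F, since `X F` meets `Q` oddly; and `F` and `e` determine
`Q`. So all repairs together cost at most 1/9 Pr(e ∈ X 𝓕) on an edge (`sum_narrowCuts_single_le`).
Averaging the two bounds with weights 9/10 and 1/10 makes the terms for `X 𝓕` and `𝓕 \ X 𝓕` add up
to 1/10 Pr(e ∈ 𝓕) ≤ x(e)/10; the total is 1/10 + 4/10 + 1/10 = 3/5.

The tree itself costs at most cᵀx on average, so the best tree yields 8/5. Tours lie in `P G T`,
which gives the comparison with them. Existence rests on compactness of `P G T` and on Hahn–Banach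
separation from the dominant of the spanning trees, with Kruskal's exchange argument behind it. For
paths, an Eulerian walk of the tour is taken and shortcut. -/

lemma exists_ends (e : G.edgeSet) : ∃ a b, G.Adj a b ∧ (e : Sym2 V) = s(a, b) := by
  obtain ⟨e, he⟩ := e
  induction e with
  | h a b => exact ⟨a, b, he, rfl⟩

lemma mem_cut {e : G.edgeSet} {a b : V} (h : (e : Sym2 V) = s(a, b)) (W : Finset V) :
    e ∈ cut G W ↔ ¬ (a ∈ W ↔ b ∈ W) := by
  simp only [cut, Finset.mem_filter, Finset.mem_univ, true_and, h, Sym2.eq_iff]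
  constructor
  · rintro ⟨u, hu, v, hv, ⟨rfl, rfl⟩ | ⟨rfl, rfl⟩⟩ <;> tauto
  · intro hab
    by_cases ha : a ∈ W
    · exact ⟨a, ha, b, by tauto, Or.inl ⟨rfl, rfl⟩⟩
    · exact ⟨b, by tauto, a, ha, Or.inr ⟨rfl, rfl⟩⟩

lemma ends_ne {e : G.edgeSet} {a b : V} (h : (e : Sym2 V) = s(a, b)) : a ≠ b := by
  have := e.2
  rw [h] at this
  exact G.ne_of_adj this

lemma cut_empty : cut G ∅ = ∅ := by
  ext e; obtain ⟨a, b, -, h⟩ := exists_ends e; simp [mem_cut h]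

lemma cut_univ : cut G Finset.univ = ∅ := by
  ext e; obtain ⟨a, b, -, h⟩ := exists_ends e; simp [mem_cut h]

lemma cut_compl (W : Finset V) : cut G Wᶜ = cut G W := by
  ext e; obtain ⟨a, b, -, h⟩ := exists_ends e; simp only [mem_cut h, Finset.mem_compl]; tauto

lemma mem_cut_symmDiff (W W' : Finset V) (e : G.edgeSet) :
    e ∈ cut G (symmDiff W W') ↔ ¬ (e ∈ cut G W ↔ e ∈ cut G W') := by
  obtain ⟨a, b, -, h⟩ := exists_ends e
  simp only [mem_cut h, Finset.mem_symmDiff]; tauto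

lemma mem_cut_singleton {e : G.edgeSet} {v : V} : e ∈ cut G {v} ↔ v ∈ (e : Sym2 V) := by
  obtain ⟨a, b, -, h⟩ := exists_ends e
  have := ends_ne h
  rw [mem_cut h, h, Sym2.mem_iff, Finset.mem_singleton, Finset.mem_singleton]
  constructor
  · intro h'; by_cases ha : a = v <;> grind
  · rintro (rfl | rfl) <;> grind

/-- Modulo 2, an edge inside `W` cancels because it is counted at both ends. -/
lemma indicator_cut_eq_sum (W : Finset V) (e : G.edgeSet) :
    (if e ∈ cut G W then 1 else 0 : ZMod 2) = ∑ v ∈ W, if e ∈ cut G {v} then 1 else 0 := by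
  obtain ⟨a, b, -, h⟩ := exists_ends e
  have hab := ends_ne h
  have : ∀ v ∈ W, (if e ∈ cut G {v} then 1 else 0 : ZMod 2)
      = (if v = a then 1 else 0) + (if v = b then 1 else 0) := by
    intro v _
    simp only [mem_cut_singleton, h, Sym2.mem_iff]
    split_ifs <;> grind
  rw [Finset.sum_congr rfl this, Finset.sum_add_distrib, Finset.sum_ite_eq', Finset.sum_ite_eq',
    if_congr (mem_cut h W) rfl rfl]
  by_cases ha : a ∈ W <;> by_cases hb : b ∈ W <;> simp [ha, hb]
  rfl

/-- The parity of a multiset of edges on a cut is determined by its odd vertices. -/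
lemma odd_sum_cut_iff {T : Finset V} {H : G.edgeSet → ℕ}
    (hT : ∀ v, v ∈ T ↔ Odd (∑ e ∈ cut G {v}, H e)) (W : Finset V) :
    Odd (∑ e ∈ cut G W, H e) ↔ Odd (W ∩ T).card := by
  rw [← ZMod.natCast_eq_one_iff_odd, ← ZMod.natCast_eq_one_iff_odd]
  have key : ∀ W : Finset V, ((∑ e ∈ cut G W, H e : ℕ) : ZMod 2)
      = ∑ e, (if e ∈ cut G W then 1 else 0) * (H e : ZMod 2) := by
    intro W; simp [Finset.sum_ite_mem]
  have h2 : (((W ∩ T).card : ℕ) : ZMod 2) = ∑ v ∈ W, ((∑ e ∈ cut G {v}, H e : ℕ) : ZMod 2) := by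
    rw [Finset.card_eq_sum_ones, ← Finset.sum_ite_mem]
    push_cast
    refine Finset.sum_congr rfl fun v _ => ?_
    split_ifs with hv
    · rw [hT, ← ZMod.natCast_eq_one_iff_odd] at hv
      rw [← hv]; push_cast; rfl
    · rw [hT, Nat.not_odd_iff_even, ← ZMod.natCast_eq_zero_iff_even] at hv
      rw [← hv]; push_cast; rfl
  rw [h2, key]
  simp only [key]
  rw [Finset.sum_comm]
  simp only [← Finset.sum_mul, ← indicator_cut_eq_sum]

lemma sum_indicator (A F : Finset G.edgeSet) :
    ∑ e ∈ A, (if e ∈ F then 1 else 0 : ℕ) = (A ∩ F).card := by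
  rw [Finset.sum_ite_mem, Finset.card_eq_sum_ones]

lemma mem_oddVerts {F : Finset G.edgeSet} {v : V} :
    v ∈ oddVerts G F ↔ Odd (cut G {v} ∩ F).card := by
  simp [oddVerts]

lemma odd_cut_inter_iff (F : Finset G.edgeSet) (W : Finset V) :
    Odd (cut G W ∩ F).card ↔ Odd (W ∩ oddVerts G F).card := by
  rw [← sum_indicator]
  exact odd_sum_cut_iff (fun v => by rw [sum_indicator, mem_oddVerts]) W

/-- The handshake lemma, read off from the empty cut of the whole vertex set. -/
lemma even_card_oddVerts (F : Finset G.edgeSet) : Even (oddVerts G F).card := by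
  have := odd_cut_inter_iff F Finset.univ
  rw [cut_univ] at this
  simpa using this

lemma odd_card_symmDiff {α : Type*} [DecidableEq α] (A B : Finset α) :
    Odd (symmDiff A B).card ↔ ¬ (Odd A.card ↔ Odd B.card) := by
  have h1 : (symmDiff A B).card + 2 * (A ∩ B).card = A.card + B.card := by
    have h3 := Finset.card_sdiff_add_card_inter A B
    have h4 := Finset.card_sdiff_add_card_inter B A
    have h5 : (symmDiff A B).card = (A \ B).card + (B \ A).card := by
      rw [symmDiff_def, Finset.sup_eq_union, Finset.card_union_of_disjoint disjoint_sdiff_sdiff]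
    rw [Finset.inter_comm B A] at h4
    omega
  grind

/-- Linearity over the field with two elements: joins can be spliced by symmetric differences. -/
lemma oddVerts_symmDiff (A B : Finset G.edgeSet) :
    oddVerts G (symmDiff A B) = symmDiff (oddVerts G A) (oddVerts G B) := by
  ext v
  have : cut G {v} ∩ symmDiff A B = symmDiff (cut G {v} ∩ A) (cut G {v} ∩ B) :=
    inf_symmDiff_distrib_left _ _ _
  rw [mem_oddVerts, this, odd_card_symmDiff, Finset.mem_symmDiff, mem_oddVerts, mem_oddVerts]
  tauto

lemma oddVerts_empty : oddVerts G ∅ = ∅ := by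
  ext v; simp [mem_oddVerts]

lemma oddVerts_singleton {e : G.edgeSet} {a b : V} (h : (e : Sym2 V) = s(a, b)) :
    oddVerts G {e} = symmDiff {a} {b} := by
  ext v
  have hab := ends_ne h
  rw [mem_oddVerts, Finset.mem_symmDiff, Finset.mem_singleton, Finset.mem_singleton]
  by_cases hv : e ∈ cut G {v}
  · rw [Finset.inter_singleton_of_mem hv]
    rw [mem_cut_singleton, h, Sym2.mem_iff] at hv
    rcases hv with rfl | rfl <;> simp [hab, hab.symm]
  · rw [Finset.inter_singleton_of_notMem hv]
    rw [mem_cut_singleton, h, Sym2.mem_iff] at hv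
    simp; tauto

/-- The graph on `V` whose edges are those of `F`. -/
def edgeGraph (F : Finset G.edgeSet) : SimpleGraph V :=
  SimpleGraph.fromEdgeSet {a : Sym2 V | ∃ e ∈ F, (e : Sym2 V) = a}

lemma edgeGraph_adj {F : Finset G.edgeSet} {u v : V} :
    (edgeGraph F).Adj u v ↔ ∃ e ∈ F, (e : Sym2 V) = s(u, v) := by
  simp only [edgeGraph, SimpleGraph.fromEdgeSet_adj, Set.mem_ofPred_eq]
  exact ⟨fun h => h.1, fun h => ⟨h, by obtain ⟨e, _, he⟩ := h; exact ends_ne he⟩⟩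

lemma edgeGraph_mono {F F' : Finset G.edgeSet} (h : F ⊆ F') : edgeGraph F ≤ edgeGraph F' := by
  intro u v huv
  rw [edgeGraph_adj] at huv ⊢
  obtain ⟨e, he, h'⟩ := huv
  exact ⟨e, h he, h'⟩

lemma mem_of_reachable {H : SimpleGraph V} {U : Set V}
    (hU : ∀ a b, H.Adj a b → a ∈ U → b ∈ U) {a b : V} (h : H.Reachable a b) (ha : a ∈ U) :
    b ∈ U := by
  obtain ⟨w⟩ := h
  induction w with
  | nil => exact ha
  | cons hab _ ih => exact ih (hU _ _ hab ha)

/-- If `F` misses the cut of `W`, then `F` does not connect `W` to its complement. -/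
lemma mem_of_reachable_of_cut {F : Finset G.edgeSet} {W : Finset V} (hW : cut G W ∩ F = ∅)
    {a b : V} (h : (edgeGraph F).Reachable a b) (ha : a ∈ W) : b ∈ W := by
  refine mem_of_reachable (U := {v | v ∈ W}) (fun u v huv hu => ?_) h ha
  obtain ⟨e, he, hs⟩ := edgeGraph_adj.1 huv
  by_contra hv
  have : e ∈ cut G W ∩ F := Finset.mem_inter.2 ⟨(mem_cut hs W).2 (by simp_all), he⟩
  simp [hW] at this

open Classical in
/-- The vertices reachable from `r` along edges of `F`. -/
noncomputable def comp (F : Finset G.edgeSet) (r : V) : Finset V :=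
  Finset.univ.filter fun v => (edgeGraph F).Reachable r v

lemma mem_comp {F : Finset G.edgeSet} {r v : V} :
    v ∈ comp F r ↔ (edgeGraph F).Reachable r v := by simp [comp]

lemma self_mem_comp (F : Finset G.edgeSet) (r : V) : r ∈ comp F r :=
  mem_comp.2 (SimpleGraph.Reachable.refl _)

lemma cut_comp_inter (F : Finset G.edgeSet) (r : V) : cut G (comp F r) ∩ F = ∅ := by
  ext e
  obtain ⟨a, b, -, h⟩ := exists_ends e
  simp only [Finset.mem_inter, mem_cut h, mem_comp, Finset.notMem_empty, iff_false, not_and]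
  intro h1 he
  have : (edgeGraph F).Adj a b := edgeGraph_adj.2 ⟨e, he, h⟩
  exact h1 ⟨fun h2 => h2.trans this.reachable, fun h2 => h2.trans this.symm.reachable⟩

lemma edgeGraph_connected_iff [Nonempty V] {F : Finset G.edgeSet} : (edgeGraph F).Connected ↔
    ∀ W : Finset V, W.Nonempty → W ≠ Finset.univ → (cut G W ∩ F).Nonempty := by
  constructor
  · intro h W ⟨a, ha⟩ hW
    by_contra hne
    rw [Finset.not_nonempty_iff_eq_empty] at hne
    exact hW (Finset.eq_univ_iff_forall.2
      fun b => mem_of_reachable_of_cut hne (h.preconnected a b) ha)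
  · intro h
    refine ⟨fun a b => ?_⟩
    by_contra hab
    obtain ⟨e, he⟩ := h (comp F a) ⟨a, self_mem_comp F a⟩
      (fun h' => hab (mem_comp.1 (h' ▸ Finset.mem_univ b)))
    simp [cut_comp_inter] at he

lemma edgeGraph_univ : edgeGraph (Finset.univ : Finset G.edgeSet) = G := by
  ext u v
  rw [edgeGraph_adj]
  constructor
  · rintro ⟨e, -, h⟩
    have := e.2
    rwa [h] at this
  · intro h
    exact ⟨⟨s(u, v), h⟩, Finset.mem_univ _, rfl⟩

/-- Connected vertices are the ends of a join. -/
lemma exists_join_of_reachable {F : Finset G.edgeSet} {u v : V}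
    (h : (edgeGraph F).Reachable u v) : ∃ X ⊆ F, oddVerts G X = symmDiff {u} {v} := by
  obtain ⟨w⟩ := h
  induction w with
  | nil => exact ⟨∅, by simp, by rw [oddVerts_empty]; simp⟩
  | @cons a b d hab _ ih =>
    obtain ⟨X, hX, hodd⟩ := ih
    obtain ⟨e, he, hs⟩ := edgeGraph_adj.1 hab
    refine ⟨symmDiff {e} X, ?_, ?_⟩
    · intro f hf
      rw [Finset.mem_symmDiff, Finset.mem_singleton] at hf
      rcases hf with ⟨rfl, _⟩ | ⟨hf, _⟩
      exacts [he, hX hf]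
    · rw [oddVerts_symmDiff, oddVerts_singleton hs, hodd, symmDiff_assoc,
        symmDiff_symmDiff_cancel_left]

/-- The ends of a join are connected by it. -/
lemma reachable_of_join {F X : Finset G.edgeSet} (hX : X ⊆ F) {u v : V}
    (hodd : oddVerts G X = symmDiff {u} {v}) : (edgeGraph F).Reachable u v := by
  by_contra h
  have huv : u ≠ v := by rintro rfl; exact h (SimpleGraph.Reachable.refl _)
  have h1 := odd_cut_inter_iff X (comp F u)
  have h2 : cut G (comp F u) ∩ X = ∅ := by
    rw [← Finset.subset_empty, ← cut_comp_inter F u]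
    exact Finset.inter_subset_inter_left hX
  have h3 : comp F u ∩ oddVerts G X = {u} := by
    ext w
    rw [hodd, Finset.mem_inter, Finset.mem_symmDiff, mem_comp]
    simp only [Finset.mem_singleton]
    constructor
    · rintro ⟨hr, ⟨rfl, _⟩ | ⟨rfl, _⟩⟩
      exacts [rfl, absurd hr h]
    · rintro rfl
      exact ⟨SimpleGraph.Reachable.refl _, Or.inl ⟨rfl, huv⟩⟩
  rw [h2, h3] at h1
  simp at h1

/-- A connected set of edges contains a `T`-join for every even `T`. -/
lemma exists_join_of_connected {F : Finset G.edgeSet} (hF : (edgeGraph F).Connected)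
    {T : Finset V} (hT : Even T.card) : ∃ X ⊆ F, oddVerts G X = T := by
  obtain ⟨r⟩ := hF.nonempty
  -- Joining the vertices of `T` one by one to a root `r` leaves at most the parity at `r` wrong;
  -- evenness of both sets then settles `r`.
  have key : ∀ T : Finset V, ∃ X ⊆ F, symmDiff (oddVerts G X) T ⊆ {r} := by
    intro T
    induction T using Finset.induction_on with
    | empty => exact ⟨∅, by simp, by rw [oddVerts_empty]; simp⟩
    | insert a T ha ih =>
      obtain ⟨X, hX, h⟩ := ih
      obtain ⟨Y, hY, h'⟩ := exists_join_of_reachable (hF.preconnected a r)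
      refine ⟨symmDiff X Y, ?_, ?_⟩
      · exact (Finset.symmDiff_subset_union).trans (Finset.union_subset hX hY)
      · rw [oddVerts_symmDiff, h']
        intro w hw
        by_cases hw' : w ∈ symmDiff (oddVerts G X) T
        · exact h hw'
        · simp only [Finset.mem_symmDiff, Finset.mem_insert, Finset.mem_singleton] at *
          by_cases hwa : w = a
          · subst hwa; tauto
          · tauto
  obtain ⟨X, hX, h⟩ := key T
  refine ⟨X, hX, ?_⟩
  have heven : ¬ Odd (symmDiff (oddVerts G X) T).card := by
    rw [odd_card_symmDiff, not_not]
    have := even_card_oddVerts X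
    grind
  rcases Finset.subset_singleton_iff.1 h with h | h
  · rw [← Finset.bot_eq_empty, symmDiff_eq_bot] at h; exact h
  · rw [h] at heven; simp at heven

/-! ## Shortest joins and the cuts of the graph -/

/-- With edges of `J` counted negatively, the effect of toggling `X` is additive over disjoint parts
of `X`. -/
lemma sum_symmDiff_eq (c : G.edgeSet → ℝ) (J X : Finset G.edgeSet) :
    ∑ e ∈ symmDiff J X, c e = ∑ e ∈ J, c e + ∑ e ∈ X, (if e ∈ J then - c e else c e) := by
  have h : ∀ A : Finset G.edgeSet, ∀ f : G.edgeSet → ℝ,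
      ∑ e ∈ A, f e = ∑ e, if e ∈ A then f e else 0 := by
    intro A f; rw [Finset.sum_ite_mem, Finset.univ_inter]
  rw [h, h J, h X, ← Finset.sum_add_distrib]
  refine Finset.sum_congr rfl fun e _ => ?_
  by_cases h1 : e ∈ J <;> by_cases h2 : e ∈ X <;> simp [Finset.mem_symmDiff, h1, h2]

lemma sum_symmDiff_le {c : G.edgeSet → ℝ} (hc : ∀ e, 0 ≤ c e) (A B : Finset G.edgeSet) :
    ∑ e ∈ symmDiff A B, c e ≤ ∑ e ∈ A, c e + ∑ e ∈ B, c e := by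
  rw [sum_symmDiff_eq]
  gcongr with e he
  have := hc e
  split_ifs <;> linarith

lemma sum_symmDiff_singleton {c : G.edgeSet → ℝ} {A : Finset G.edgeSet} {e : G.edgeSet}
    (he : e ∈ A) : ∑ f ∈ symmDiff A {e}, c f = ∑ f ∈ A, c f - c e := by
  rw [sum_symmDiff_eq, Finset.sum_singleton, if_pos he]; ring

lemma symmDiff_trans {α : Type*} [DecidableEq α] (A B C : Finset α) :
    symmDiff (symmDiff A B) (symmDiff B C) = symmDiff A C := by
  rw [symmDiff_assoc, symmDiff_symmDiff_cancel_left]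

lemma symmDiff_swap_trans {α : Type*} [DecidableEq α] (A B C : Finset α) :
    symmDiff (symmDiff A B) (symmDiff A C) = symmDiff B C := by
  rw [symmDiff_comm A B, symmDiff_trans]

/-- Bookkeeping of ends: a join with ends `R`, `B` is toggled along an edge `A`, `C` and rerouted
from `B` to `A` through `D`. -/
lemma symmDiff_four_cancel {α : Type*} [DecidableEq α] (T R B A C D : Finset α) :
    symmDiff (symmDiff (symmDiff T (symmDiff R B)) (symmDiff A C))
      (symmDiff (symmDiff B D) (symmDiff A D)) = symmDiff T (symmDiff R C) := by
  have h : symmDiff (symmDiff B D) (symmDiff A D) = symmDiff B A := by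
    rw [symmDiff_comm A D, symmDiff_trans]
  rw [h, symmDiff_assoc, symmDiff_assoc, symmDiff_comm A C, symmDiff_comm B A, symmDiff_trans,
    symmDiff_comm C B, symmDiff_trans]

lemma exists_ends_of_mem_cut {e : G.edgeSet} {W : Finset V} (he : e ∈ cut G W) :
    ∃ a b, a ∈ W ∧ b ∉ W ∧ (e : Sym2 V) = s(a, b) := by
  simp only [cut, Finset.mem_filter, Finset.mem_univ, true_and] at he
  obtain ⟨u, hu, v, hv, h⟩ := he
  exact ⟨u, v, hu, hv, h⟩

set_option maxHeartbeats 400000 in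
/-- If no `T`-join has length `0`, then some cut of edges of positive length meets every shortest
`T`-join in exactly one edge. -/
lemma exists_cut_inter_shortest {c : G.edgeSet → ℝ} (hc : ∀ e, 0 ≤ c e) {T : Finset V}
    {J₀ : Finset G.edgeSet} (hJ₀ : IsShortestTJoin G T c J₀) (hpos : 0 < ∑ e ∈ J₀, c e) :
    ∃ D : Finset V, (∀ e ∈ cut G D, 0 < c e) ∧
      ∀ J, IsShortestTJoin G T c J → (cut G D ∩ J).card = 1 := by
  classical
  -- The cut is built around an end `v` of a cheapest join whose parity may be wrong at two vertices
  -- `r`, `v`. Dropping an edge of positive length from `J₀` shows that it beats every `T`-join.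
  obtain ⟨⟨r, v, K⟩, hK, hmin⟩ := Finset.exists_min_image
    (Finset.univ.filter fun p : V × V × Finset G.edgeSet =>
      oddVerts G p.2.2 = symmDiff T (symmDiff {p.1} {p.2.1}))
    (fun p => ∑ e ∈ p.2.2, c e) (by
      obtain ⟨e, he, -⟩ := Finset.exists_ne_zero_of_sum_ne_zero hpos.ne'
      obtain ⟨a, b, -, hs⟩ := exists_ends e
      refine ⟨(a, a, J₀), ?_⟩
      simp only [Finset.mem_filter, Finset.mem_univ, true_and, symmDiff_self]
      rw [symmDiff_bot]; exact hJ₀.1)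
  simp only [Finset.mem_filter, Finset.mem_univ, true_and, Prod.forall] at hK hmin
  have hKJ : ∑ e ∈ K, c e < ∑ e ∈ J₀, c e := by
    obtain ⟨e, he, hce⟩ := Finset.exists_ne_zero_of_sum_ne_zero hpos.ne'
    obtain ⟨a, b, -, hs⟩ := exists_ends e
    have h1 := hmin a b (symmDiff J₀ {e})
      (by rw [oddVerts_symmDiff, oddVerts_singleton hs, hJ₀.1])
    rw [sum_symmDiff_singleton he] at h1
    have := lt_of_le_of_ne (hc e) hce.symm
    linarith
  -- The vertices at distance 0 from `v`. If `r` were among them, `K` could be completed to a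
  -- `T`-join for free.
  let D : Finset V := Finset.univ.filter fun u =>
    ∃ Z : Finset G.edgeSet, oddVerts G Z = symmDiff {u} {v} ∧ ∑ e ∈ Z, c e ≤ 0
  have hD : ∀ u, u ∈ D ↔
      ∃ Z : Finset G.edgeSet, oddVerts G Z = symmDiff {u} {v} ∧ ∑ e ∈ Z, c e ≤ 0 := by
    intro u; simp [D]
  have hvD : v ∈ D := (hD v).2 ⟨∅, by rw [oddVerts_empty]; simp, by simp⟩
  have hrD : r ∉ D := by
    rw [hD]
    rintro ⟨Z, hZ, hZc⟩
    have h1 := hJ₀.2 (symmDiff K Z) (by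
      rw [IsTJoin, oddVerts_symmDiff, hK, hZ, symmDiff_symmDiff_cancel_right])
    have h2 := sum_symmDiff_le hc K Z
    linarith
  have hcD : ∀ e ∈ cut G D, 0 < c e := by
    intro e he
    obtain ⟨a, b, ha, hb, hs⟩ := exists_ends_of_mem_cut he
    by_contra h
    obtain ⟨Z, hZ, hZc⟩ := (hD a).1 ha
    refine hb ((hD b).2 ⟨symmDiff {e} Z, ?_, ?_⟩)
    · rw [oddVerts_symmDiff, hZ, oddVerts_singleton hs, symmDiff_swap_trans]
    · have := sum_symmDiff_le hc {e} Z
      rw [Finset.sum_singleton] at this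
      linarith
  refine ⟨D, hcD, fun J hJ => ?_⟩
  have hJJ : ∑ e ∈ J, c e = ∑ e ∈ J₀, c e := le_antisymm (hJ.2 _ hJ₀.1) (hJ₀.2 _ hJ.1)
  have hrv : r ≠ v := fun h => hrD (h ▸ hvD)
  -- `X` links `r` to `v`, so it must enter `D`. Below, `X₁ ⊆ X` links `r` to `b ∈ D`, and its only
  -- edge in the cut of `D` is `e₀`.
  set X := symmDiff J K with hX
  have hXo : oddVerts G X = symmDiff {r} {v} := by
    rw [hX, oddVerts_symmDiff, hJ.1, hK, symmDiff_symmDiff_cancel_left]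
  set F := X \ cut G D with hF
  have hDF : cut G Dᶜ ∩ F = ∅ := by
    rw [cut_compl]; ext e; simp [hF]
  have hAD : ∀ a ∈ comp F r, a ∉ D := by
    intro a ha
    have := mem_of_reachable_of_cut hDF (mem_comp.1 ha) (Finset.mem_compl.2 hrD)
    exact Finset.mem_compl.1 this
  have hodd : Odd (cut G (comp F r) ∩ X).card := by
    rw [odd_cut_inter_iff, hXo]
    have : comp F r ∩ symmDiff {r} {v} = {r} := by
      ext w
      simp only [Finset.mem_inter, Finset.mem_symmDiff, Finset.mem_singleton]
      constructor
      · rintro ⟨h1, ⟨rfl, _⟩ | ⟨rfl, _⟩⟩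
        exacts [rfl, absurd hvD (hAD _ h1)]
      · rintro rfl
        exact ⟨self_mem_comp _ _, Or.inl ⟨rfl, hrv⟩⟩
    simp [this]
  obtain ⟨e₀, he₀⟩ := Finset.card_pos.1 hodd.pos
  obtain ⟨he₀A, he₀X⟩ := Finset.mem_inter.1 he₀
  have he₀F : e₀ ∉ F := fun h => by
    have : e₀ ∈ cut G (comp F r) ∩ F := Finset.mem_inter.2 ⟨he₀A, h⟩
    simp [cut_comp_inter] at this
  have he₀D : e₀ ∈ cut G D := by
    by_contra h
    exact he₀F (Finset.mem_sdiff.2 ⟨he₀X, h⟩)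
  obtain ⟨a, b, ha, -, hs⟩ := exists_ends_of_mem_cut he₀A
  have hb : b ∈ D := by
    by_contra hb
    exact (mem_cut hs D).1 he₀D (iff_of_false (hAD a ha) hb)
  obtain ⟨X₀, hX₀F, hX₀⟩ := exists_join_of_reachable (mem_comp.1 ha)
  set X₁ := symmDiff X₀ {e₀} with hX₁
  have hX₁o : oddVerts G X₁ = symmDiff {r} {b} := by
    rw [hX₁, oddVerts_symmDiff, hX₀, oddVerts_singleton hs, symmDiff_trans]
  have hmemX₁ : ∀ e, e ∈ X₁ ↔ e ∈ X₀ ∨ e = e₀ := by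
    intro e
    rw [hX₁, (Finset.disjoint_singleton_right.2 fun h => he₀F (hX₀F h)).symmDiff_eq_sup,
      Finset.sup_eq_union, Finset.mem_union, Finset.mem_singleton]
  have hX₁X : X₁ ⊆ X := by
    intro e he
    rcases (hmemX₁ e).1 he with h | rfl
    exacts [(Finset.mem_sdiff.1 (hX₀F h)).1, he₀X]
  obtain ⟨Z, hZ, hZc⟩ := (hD b).1 hb
  -- The remainder `X \ X₁` links `b` to `v`, which are at distance 0, so toggling it cannot shorten
  -- the shortest join `J`.
  have hX₂ : ∑ e ∈ J, c e ≤ ∑ e ∈ symmDiff J (X \ X₁), c e := by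
    have h1 : X \ X₁ = symmDiff X X₁ := (symmDiff_of_ge hX₁X).symm
    have h2 := hJ.2 (symmDiff (symmDiff J (X \ X₁)) Z) (by
      rw [IsTJoin, oddVerts_symmDiff, oddVerts_symmDiff, hZ, h1, oddVerts_symmDiff, hXo, hX₁o, hJ.1,
        symmDiff_swap_trans, symmDiff_comm ({v} : Finset V), symmDiff_symmDiff_cancel_right])
    have h3 := sum_symmDiff_le hc (symmDiff J (X \ X₁)) Z
    linarith
  -- Toggling all of `X` turns `J` into `K`, and the part outside `X₁` brings no gain; so `X₁` alone
  -- does at least as well.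
  have hK₁ : ∑ e ∈ symmDiff J X₁, c e ≤ ∑ e ∈ K, c e := by
    have h1 : K = symmDiff J X := by rw [hX, symmDiff_symmDiff_cancel_left]
    rw [h1]
    rw [sum_symmDiff_eq] at hX₂
    rw [sum_symmDiff_eq c J X₁, sum_symmDiff_eq c J X, ← Finset.sum_sdiff hX₁X]
    linarith
  have hK₁o : oddVerts G (symmDiff J X₁) = symmDiff T (symmDiff {r} {b}) := by
    rw [oddVerts_symmDiff, hJ.1, hX₁o]
  -- Removing such an edge and moving the defect from `b` to its end in `D` for free would beat the
  -- minimum `K`. Hence `J` and `X₁` agree on the cut of `D`.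
  have hno : ∀ e ∈ cut G D, e ∉ symmDiff J X₁ := by
    intro e he heK
    obtain ⟨a', b', ha', -, hs'⟩ := exists_ends_of_mem_cut he
    obtain ⟨Z', hZ', hZc'⟩ := (hD a').1 ha'
    have h1 := hmin r b' (symmDiff (symmDiff (symmDiff J X₁) {e}) (symmDiff Z Z')) (by
      rw [oddVerts_symmDiff, oddVerts_symmDiff, hK₁o, oddVerts_singleton hs', oddVerts_symmDiff, hZ,
        hZ', symmDiff_four_cancel])
    have h2 := sum_symmDiff_le hc (symmDiff (symmDiff J X₁) {e}) (symmDiff Z Z')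
    have h3 := sum_symmDiff_le hc Z Z'
    rw [sum_symmDiff_singleton heK] at h2
    have h4 := hcD e he
    linarith
  rw [Finset.card_eq_one]
  refine ⟨e₀, ?_⟩
  ext e
  rw [Finset.mem_inter, Finset.mem_singleton]
  have h1 : e ∈ cut G D → (e ∈ J ↔ e ∈ X₁) := by
    intro he
    have := hno e he
    rw [Finset.mem_symmDiff, ← xor_def, xor_iff_not_iff, not_not] at this
    exact this
  have h2 : e ∈ cut G D → (e ∈ X₁ ↔ e = e₀) := by
    intro he
    rw [hmemX₁]
    exact or_iff_right fun h => (Finset.mem_sdiff.1 (hX₀F h)).2 he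
  constructor
  · rintro ⟨h3, h4⟩
    exact (h2 h3).1 ((h1 h3).1 h4)
  · rintro rfl
    exact ⟨he₀D, (h1 he₀D).2 ((h2 he₀D).2 rfl)⟩

/-! ### The `T`-join polyhedron -/

lemma exists_shortest {T : Finset V} (h : ∃ J, IsTJoin G T J) (c : G.edgeSet → ℝ) :
    ∃ J, IsShortestTJoin G T c J := by
  classical
  obtain ⟨J₀, hJ₀⟩ := h
  obtain ⟨J, hJ, hmin⟩ := Finset.exists_min_image
    (Finset.univ.filter fun J : Finset G.edgeSet => IsTJoin G T J) (fun J => ∑ e ∈ J, c e)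
    ⟨J₀, by simpa using hJ₀⟩
  simp only [Finset.mem_filter, Finset.mem_univ, true_and] at hJ hmin
  exact ⟨J, hJ, hmin⟩

open Filter Topology in
/-- **Edmonds–Johnson**: a nonnegative vector that is at least `1` on every `T`-cut costs at least
as much as some `T`-join. -/
theorem exists_tjoin_le_dot {c y : G.edgeSet → ℝ} (hc : ∀ e, 0 ≤ c e) (hy : ∀ e, 0 ≤ y e)
    {T : Finset V} (hT : ∃ J, IsTJoin G T J)
    (hcut : ∀ W : Finset V, Odd (W ∩ T).card → 1 ≤ ∑ e ∈ cut G W, y e) :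
    ∃ J, IsTJoin G T J ∧ ∑ e ∈ J, c e ≤ dot c y := by
  classical
  obtain ⟨J₀, hJ₀, hmin₀⟩ := exists_shortest hT c
  by_contra! hcon
  set δ := ∑ e ∈ J₀, c e - dot c y with hδ
  have hδpos : 0 < δ := sub_pos.2 (hcon J₀ hJ₀)
  -- Costs below `c` that keep the gap `δ`. One of minimum total cost is lowered further on the cut
  -- `D`: the minimum join loses exactly `ε`, while `dot d y` loses at least `ε` because `y` is at
  -- least 1 there, so the gap survives.
  let S : Set (G.edgeSet → ℝ) :=
    Set.Icc 0 c ∩ ⋂ J : {J : Finset G.edgeSet // IsTJoin G T J},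
      {d | δ ≤ ∑ e ∈ J.1, d e - dot d y}
  have hS : IsCompact S := by
    refine isCompact_Icc.inter_right (isClosed_iInter fun J => isClosed_le continuous_const ?_)
    unfold dot; fun_prop
  have hcS : c ∈ S := by
    refine ⟨⟨hc, le_rfl⟩, Set.mem_iInter.2 fun J => ?_⟩
    have := hmin₀ J.1 J.2
    show δ ≤ ∑ e ∈ J.1, c e - dot c y
    linarith
  obtain ⟨d, ⟨⟨hd0, hdc⟩, hdJ⟩, hdmin⟩ := hS.exists_isMinOn ⟨c, hcS⟩
    (f := fun d => ∑ e, d e) (by fun_prop)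
  have hdJ' : ∀ J, IsTJoin G T J → δ ≤ ∑ e ∈ J, d e - dot d y :=
    fun J hJ => Set.mem_iInter.1 hdJ ⟨J, hJ⟩
  have hd0' : ∀ e, 0 ≤ d e := hd0
  obtain ⟨J₁, hJ₁⟩ := exists_shortest hT d
  have hdy : 0 ≤ dot d y := Finset.sum_nonneg fun e _ => mul_nonneg (hd0' e) (hy e)
  have hJ₁pos : 0 < ∑ e ∈ J₁, d e := by linarith [hdJ' J₁ hJ₁.1]
  obtain ⟨D, hD, hDJ⟩ := exists_cut_inter_shortest hd0' hJ₁ hJ₁pos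
  have hoddD : Odd (D ∩ T).card := by
    have h1 : oddVerts G J₁ = T := hJ₁.1
    rw [← h1, ← odd_cut_inter_iff, hDJ J₁ hJ₁]; exact odd_one
  -- Shortest joins meet the cut exactly once; the finitely many others have slack, so a small `ε`
  -- keeps `J₁` shortest.
  have hev : ∀ᶠ ε in 𝓝[>] (0 : ℝ), 0 < ε ∧ (∀ e, e ∈ cut G D → ε ≤ d e) ∧
      ∀ J, IsTJoin G T J → ∑ e ∈ J₁, d e - ε ≤ ∑ e ∈ J, d e - ε * (cut G D ∩ J).card := by
    refine Filter.Eventually.and self_mem_nhdsWithin (Filter.Eventually.and ?_ ?_)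
    · rw [eventually_all]
      intro e
      by_cases he : e ∈ cut G D
      · filter_upwards [Ioo_mem_nhdsGT (hD e he)] with ε hε _ using hε.2.le
      · exact Eventually.of_forall fun ε h => absurd h he
    · rw [eventually_all]
      intro J
      by_cases hJ : IsTJoin G T J
      · by_cases hJs : IsShortestTJoin G T d J
        · refine Eventually.of_forall fun ε _ => ?_
          rw [hDJ J hJs]
          have := hJ₁.2 J hJ
          simpa using this
        · have hlt : ∑ e ∈ J₁, d e < ∑ e ∈ J, d e := by
            by_contra! h
            exact hJs ⟨hJ, fun J' hJ' => h.trans (hJ₁.2 J' hJ')⟩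
          have ht : Tendsto (fun ε : ℝ => ∑ e ∈ J, d e - ε * (cut G D ∩ J).card + ε) (𝓝[>] 0)
              (𝓝 (∑ e ∈ J, d e - 0 * (cut G D ∩ J).card + 0)) := by
            refine Tendsto.mono_left (Continuous.tendsto ?_ 0) nhdsWithin_le_nhds
            fun_prop
          filter_upwards [ht.eventually_const_lt (u := ∑ e ∈ J₁, d e) (by simpa using hlt)]
            with ε hε _
          linarith
      · exact Eventually.of_forall fun ε h => absurd h hJ
  obtain ⟨ε, hε, hεD, hεJ⟩ := hev.exists
  let d' : G.edgeSet → ℝ := fun e => d e - if e ∈ cut G D then ε else 0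
  have hsum : ∀ J : Finset G.edgeSet,
      ∑ e ∈ J, d' e = ∑ e ∈ J, d e - ε * (cut G D ∩ J).card := by
    intro J
    simp only [d', Finset.sum_sub_distrib, Finset.sum_ite_mem, Finset.sum_const, nsmul_eq_mul,
      Finset.inter_comm J]
    ring
  have hdot : dot d' y = dot d y - ε * ∑ e ∈ cut G D, y e := by
    simp only [dot, d', sub_mul, Finset.sum_sub_distrib, ite_mul, zero_mul, Finset.sum_ite_mem,
      Finset.univ_inter, Finset.mul_sum]
  have hd'S : d' ∈ S := by
    refine ⟨⟨fun e => ?_, fun e => ?_⟩, Set.mem_iInter.2 fun J => ?_⟩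
    · simp only [d', Pi.zero_apply]
      split_ifs with h
      · linarith [hεD e h]
      · linarith [hd0' e]
    · simp only [d']
      have := hdc e
      split_ifs <;> linarith
    · show δ ≤ ∑ e ∈ J.1, d' e - dot d' y
      rw [hsum, hdot]
      have h1 := hεJ J.1 J.2
      have h2 := hdJ' J₁ hJ₁.1
      have h3 := mul_le_mul_of_nonneg_left (hcut D hoddD) hε.le
      linarith
  have hlt := hdmin hd'S
  simp only [Set.mem_ofPred_eq] at hlt
  rw [hsum] at hlt
  have : 0 < (cut G D ∩ Finset.univ).card := by
    have h1 := hDJ J₁ hJ₁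
    have h2 := Finset.card_le_card (Finset.inter_subset_inter_left
      (Finset.subset_univ J₁) : cut G D ∩ J₁ ⊆ cut G D ∩ Finset.univ)
    omega
  have : (0 : ℝ) < (cut G D ∩ Finset.univ).card := by exact_mod_cast this
  have := mul_pos hε this
  linarith

/-! ## Convex combinations of spanning trees -/

lemma comp_eq {F : Finset G.edgeSet} {a b : V} (h : b ∈ comp F a) : comp F b = comp F a := by
  ext v
  rw [mem_comp] at h
  rw [mem_comp, mem_comp]
  exact ⟨h.trans, h.symm.trans⟩

lemma comp_mono {F F' : Finset G.edgeSet} (h : F ⊆ F') (a : V) : comp F a ⊆ comp F' a :=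
  fun _ hv => mem_comp.2 ((mem_comp.1 hv).mono (edgeGraph_mono h))

lemma mem_comp_of_adj {F : Finset G.edgeSet} {r a b : V} (ha : a ∈ comp F r)
    (hab : (edgeGraph F).Adj a b) : b ∈ comp F r :=
  mem_comp.2 ((mem_comp.1 ha).trans hab.reachable)

lemma mem_comp_comm {F : Finset G.edgeSet} {a b : V} : a ∈ comp F b ↔ b ∈ comp F a := by
  rw [mem_comp, mem_comp, SimpleGraph.reachable_comm]

lemma edgeGraph_insert_adj {F : Finset G.edgeSet} {e : G.edgeSet} {a b : V}
    (he : (e : Sym2 V) = s(a, b)) {u v : V} (h : (edgeGraph (insert e F)).Adj u v) :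
    (edgeGraph F).Adj u v ∨ (u = a ∧ v = b) ∨ (u = b ∧ v = a) := by
  obtain ⟨f, hf, hs⟩ := edgeGraph_adj.1 h
  rcases Finset.mem_insert.1 hf with rfl | hf
  · right
    rw [he, Sym2.eq_iff] at hs
    grind
  · exact Or.inl (edgeGraph_adj.2 ⟨f, hf, hs⟩)

/-- The new edge merges at most the components of its two ends and leaves all others unchanged.
Components are counted as distinct vertex sets. -/
lemma card_comp_le_insert (F : Finset G.edgeSet) (e : G.edgeSet) :
    (Finset.univ.image (comp F)).card ≤ (Finset.univ.image (comp (insert e F))).card + 1 := by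
  obtain ⟨a, b, -, he⟩ := exists_ends e
  set F' := insert e F with hF'
  have hFF' : F ⊆ F' := Finset.subset_insert _ _
  have hab : b ∈ comp F' a := mem_comp_of_adj (self_mem_comp _ _)
    (edgeGraph_adj.2 ⟨e, Finset.mem_insert_self _ _, he⟩)
  have hsub : Finset.univ.image (comp F) ⊆
      insert (comp F a) (insert (comp F b) ((Finset.univ.image (comp F')).erase (comp F' a))) := by
    intro W hW
    obtain ⟨v, -, rfl⟩ := Finset.mem_image.1 hW
    rw [Finset.mem_insert, Finset.mem_insert, Finset.mem_erase, Finset.mem_image]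
    by_cases hv : v ∈ comp F' a
    · have : v ∈ {w | w ∈ comp F a ∨ w ∈ comp F b} := by
        refine mem_of_reachable (fun u w huw hu => ?_) (mem_comp.1 hv) (Or.inl (self_mem_comp _ _))
        rcases edgeGraph_insert_adj he huw with h | ⟨-, rfl⟩ | ⟨-, rfl⟩
        · exact hu.imp (fun hu => mem_comp_of_adj hu h) (fun hu => mem_comp_of_adj hu h)
        · exact Or.inr (self_mem_comp _ _)
        · exact Or.inl (self_mem_comp _ _)
      rcases this with h | h
      · exact Or.inl (comp_eq h)
      · exact Or.inr (Or.inl (comp_eq h))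
    · refine Or.inr (Or.inr ⟨fun h => hv ?_, v,
        Finset.mem_univ _, ?_⟩)
      · rw [← h]; exact self_mem_comp F v
      · refine (Finset.Subset.antisymm (comp_mono hFF' v) fun w hw => ?_).symm
        refine mem_of_reachable (U := {w | w ∈ comp F v}) (fun x y hxy hx => ?_) (mem_comp.1 hw)
          (self_mem_comp _ _)
        have hx' : x ∈ comp F v := hx
        rcases edgeGraph_insert_adj he hxy with h | ⟨rfl, -⟩ | ⟨rfl, -⟩
        · exact mem_comp_of_adj hx' h
        · exact absurd (mem_comp_comm.1 (comp_mono hFF' v hx')) hv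
        · have h1 := comp_eq (comp_mono hFF' v hx')
          have h2 := comp_eq hab
          exact absurd (h2 ▸ h1 ▸ self_mem_comp F' v) hv
  have h1 := Finset.card_le_card hsub
  have h2 := Finset.card_insert_le (comp F a)
    (insert (comp F b) ((Finset.univ.image (comp F')).erase (comp F' a)))
  have h3 := Finset.card_insert_le (comp F b) ((Finset.univ.image (comp F')).erase (comp F' a))
  have h4 : comp F' a ∈ Finset.univ.image (comp F') :=
    Finset.mem_image_of_mem _ (Finset.mem_univ a)
  have h5 := Finset.card_erase_add_one h4
  omega

lemma card_le_card_add_card_comp (F : Finset G.edgeSet) :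
    Fintype.card V ≤ F.card + (Finset.univ.image (comp F)).card := by
  induction F using Finset.induction_on with
  | empty =>
    have : Function.Injective (comp (∅ : Finset G.edgeSet)) := by
      intro a b h
      by_contra hab
      have h1 : a ∈ comp (∅ : Finset G.edgeSet) b := h ▸ self_mem_comp _ a
      have : a ∈ ({b} : Set V) := mem_of_reachable (fun u v huv _ => by
        simp [edgeGraph_adj] at huv) (mem_comp.1 h1) rfl
      exact hab this
    rw [Finset.card_image_of_injective _ this, Finset.card_univ]; simp
  | insert e F he ih =>
    have := card_comp_le_insert F e
    rw [Finset.card_insert_of_notMem he]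
    omega

lemma card_edgeGraph (F : Finset G.edgeSet) : Nat.card (edgeGraph F).edgeSet = F.card := by
  have : (edgeGraph F).edgeSet = Subtype.val '' (F : Set G.edgeSet) := by
    ext a
    induction a with
    | h u v =>
      rw [SimpleGraph.mem_edgeSet, edgeGraph_adj]
      simp
  rw [this, Nat.card_coe_set_eq, Set.ncard_image_of_injective _ Subtype.val_injective,
    Set.ncard_coe_finset]

lemma isSpanningTree_iff {F : Finset G.edgeSet} :
    IsSpanningTree G F ↔ (edgeGraph F).Connected ∧ F.card + 1 = Fintype.card V := by
  rw [← card_edgeGraph, ← Nat.card_eq_fintype_card]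
  exact SimpleGraph.isTree_iff_connected_and_card

lemma exists_isSpanningTree (hG : G.Connected) : ∃ F, IsSpanningTree G F := by
  classical
  obtain ⟨T, hT, htree⟩ := hG.exists_isTree_le
  refine ⟨Finset.univ.filter fun e => (e : Sym2 V) ∈ T.edgeSet, ?_⟩
  have : edgeGraph (Finset.univ.filter fun e : G.edgeSet => (e : Sym2 V) ∈ T.edgeSet) = T := by
    ext u v
    rw [edgeGraph_adj]
    constructor
    · rintro ⟨e, he, hs⟩
      rw [Finset.mem_filter, hs] at he
      exact he.2
    · intro h
      exact ⟨⟨s(u, v), hT h⟩, by simpa using h, rfl⟩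
  show (edgeGraph _).IsTree
  rwa [this]

open Classical in
/-- The partition of `V` into the components of `(V, F)`. -/
noncomputable def compPartition (F : Finset G.edgeSet) : Finpartition (Finset.univ : Finset V) :=
  Finpartition.ofSetoid (edgeGraph F).reachableSetoid

lemma compPartition_parts (F : Finset G.edgeSet) :
    (compPartition F).parts = Finset.univ.image (comp F) := by
  classical
  have h : ∀ a, (Finset.univ.filter fun b => (edgeGraph F).reachableSetoid a b) = comp F a := by
    intro a
    ext v
    rw [mem_comp, Finset.mem_filter]
    exact and_iff_right (Finset.mem_univ v)
  simp only [compPartition, Finpartition.ofSetoid, Finpartition.ofSetSetoid]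
  exact Finset.image_congr fun a _ => by convert h a

/-- In a tree `F` of minimum length, the edges of length at most `r` connect the ends of all edges
of length at most `r`. -/
lemma lt_of_mem_multicut {c : G.edgeSet → ℝ} {F : Finset G.edgeSet} (hF : IsSpanningTree G F)
    (hmin : ∀ F', IsSpanningTree G F' → ∑ e ∈ F, c e ≤ ∑ e ∈ F', c e) {r : ℝ} {e : G.edgeSet}
    (he : e ∈ multicut G (compPartition (F.filter fun e => c e ≤ r))) : r < c e := by
  by_contra! hr
  have hconn := (isSpanningTree_iff.1 hF).1
  have := hconn.nonempty
  rw [multicut, Finset.mem_biUnion, compPartition_parts] at he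
  obtain ⟨W, hW, heW⟩ := he
  obtain ⟨w, -, rfl⟩ := Finset.mem_image.1 hW
  obtain ⟨u, v, hu, hv, hs⟩ := exists_ends_of_mem_cut heW
  have huv : ¬ (edgeGraph (F.filter fun e => c e ≤ r)).Reachable u v :=
    fun h => hv (mem_comp.2 ((mem_comp.1 hu).trans h))
  have heF : e ∉ F := fun h =>
    huv (edgeGraph_adj.2 ⟨e, Finset.mem_filter.2 ⟨h, hr⟩, hs⟩ : (edgeGraph _).Adj u v).reachable
  -- Kruskal's exchange: the tree path between the ends of `e` contains some `f` longer than `r`,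
  -- and exchanging `f` for `e` would give a shorter tree.
  obtain ⟨X, hXF, hX⟩ := exists_join_of_reachable (hconn.preconnected u v)
  obtain ⟨f, hfX, hf⟩ : ∃ f ∈ X, r < c f := by
    by_contra! h
    exact huv (reachable_of_join (fun f hf => Finset.mem_filter.2 ⟨hXF hf, h f hf⟩) hX)
  have hfF := hXF hfX
  have hcard : (insert e (F.erase f)).card = F.card := by
    rw [Finset.card_insert_of_notMem (fun h => heF (Finset.mem_of_mem_erase h)),
      Finset.card_erase_add_one hfF]
  have htree : IsSpanningTree G (insert e (F.erase f)) := by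
    refine isSpanningTree_iff.2 ⟨edgeGraph_connected_iff.2 fun W hW1 hW2 => ?_, ?_⟩
    · by_cases h : ∃ g ∈ cut G W ∩ F, g ≠ f
      · obtain ⟨g, hg, hgf⟩ := h
        obtain ⟨hg1, hg2⟩ := Finset.mem_inter.1 hg
        exact ⟨g, Finset.mem_inter.2 ⟨hg1, Finset.mem_insert_of_mem
          (Finset.mem_erase.2 ⟨hgf, hg2⟩)⟩⟩
      · push Not at h
        obtain ⟨g, hg⟩ := edgeGraph_connected_iff.1 hconn W hW1 hW2
        have hfW : f ∈ cut G W := by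
          rw [← h g hg]; exact (Finset.mem_inter.1 hg).1
        -- If `f` is the only tree edge of the cut, the path `X` crosses it once; so `W` separates
        -- the ends of `e`, and `e` replaces `f`.
        have h1 : cut G W ∩ X = {f} := by
          ext g
          rw [Finset.mem_inter, Finset.mem_singleton]
          constructor
          · rintro ⟨hg1, hg2⟩
            exact h g (Finset.mem_inter.2 ⟨hg1, hXF hg2⟩)
          · rintro rfl
            exact ⟨hfW, hfX⟩
        have h2 := odd_cut_inter_iff X W
        rw [h1, hX, Finset.card_singleton] at h2
        have h3 : Odd (W ∩ symmDiff {u} {v}).card := h2.1 odd_one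
        refine ⟨e, Finset.mem_inter.2 ⟨(mem_cut hs W).2 fun h => ?_, Finset.mem_insert_self _ _⟩⟩
        have hne := ends_ne hs
        have h4 : symmDiff {u} {v} = ({u, v} : Finset V) := by
          ext w
          simp only [Finset.mem_symmDiff, Finset.mem_singleton, Finset.mem_insert]
          grind
        rw [h4] at h3
        by_cases hu : u ∈ W
        · have hv := h.1 hu
          rw [Finset.inter_insert_of_mem hu, Finset.inter_singleton_of_mem hv,
            Finset.card_pair hne] at h3
          exact absurd h3 (by decide)
        · have hv : v ∉ W := fun hv => hu (h.2 hv)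
          rw [Finset.inter_insert_of_notMem hu, Finset.inter_singleton_of_notMem hv] at h3
          simp at h3
    · rw [hcard]; exact (isSpanningTree_iff.1 hF).2
  have h1 := hmin _ htree
  rw [Finset.sum_insert (fun h => heF (Finset.mem_of_mem_erase h)),
    ← Finset.add_sum_erase F c hfF] at h1
  linarith

/-- Layer-cake summation by parts. -/
lemma sum_mul_nonneg_of_levels {ι : Type*} [Fintype ι] (d : ι → ℝ) (n : ℕ) :
    ∀ c : ι → ℝ, (∀ e, 0 ≤ c e) → (∀ r, 0 ≤ r → 0 ≤ ∑ e with r < c e, d e) →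
      (Finset.univ.filter fun e => 0 < c e).card ≤ n → 0 ≤ ∑ e, c e * d e := by
  induction n with
  | zero =>
    intro c hc _ hn
    rw [Nat.le_zero, Finset.card_eq_zero] at hn
    refine (Finset.sum_eq_zero fun e _ => ?_).ge
    have : e ∉ Finset.univ.filter fun e => 0 < c e := by simp [hn]
    simp only [Finset.mem_filter, Finset.mem_univ, true_and, not_lt] at this
    rw [le_antisymm this (hc e), zero_mul]
  | succ n ih =>
    intro c hc hd hn
    by_cases hne : (Finset.univ.filter fun e => 0 < c e).Nonempty
    · obtain ⟨e₀, he₀, hmin⟩ := Finset.exists_min_image _ c hne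
      simp only [Finset.mem_filter, Finset.mem_univ, true_and] at he₀ hmin
      -- Subtracting the least positive value on the support removes `e₀` from it; the subtracted
      -- layer is the level set for r = 0, and the other level sets are shifted.
      have h0 := ih (fun e => if 0 < c e then c e - c e₀ else 0) (fun e => ?_) (fun r hr => ?_) ?_
      · have h1 : ∑ e, c e * d e = ∑ e, (if 0 < c e then c e - c e₀ else 0) * d e
            + c e₀ * ∑ e with 0 < c e, d e := by
          rw [Finset.mul_sum, Finset.sum_filter, ← Finset.sum_add_distrib]
          refine Finset.sum_congr rfl fun e _ => ?_
          split_ifs with h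
          · ring
          · rw [le_antisymm (not_lt.1 h) (hc e)]; ring
        rw [h1]
        exact add_nonneg h0 (mul_nonneg he₀.le (hd 0 le_rfl))
      · split_ifs with h
        · exact sub_nonneg.2 (hmin e h)
        · exact le_rfl
      · convert hd (r + c e₀) (by linarith) using 2
        ext e
        simp only [Finset.mem_filter, Finset.mem_univ, true_and]
        split_ifs with h
        · exact lt_sub_iff_add_lt
        · constructor <;> intro <;> linarith
      · refine Nat.lt_succ_iff.1 (lt_of_lt_of_le (Finset.card_lt_card ?_) hn)
        refine Finset.ssubset_iff_subset_ne.2 ⟨fun e he => ?_, fun h => ?_⟩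
        · simp only [Finset.mem_filter, Finset.mem_univ, true_and] at he ⊢
          by_contra h
          rw [if_neg h] at he
          exact lt_irrefl _ he
        · have : e₀ ∈ Finset.univ.filter fun e => 0 < c e := by simpa using he₀
          rw [← h] at this
          simp [he₀] at this
    · rw [Finset.not_nonempty_iff_eq_empty] at hne
      exact ih c hc hd (by simp [hne])

/-- A vector satisfying the partition inequalities costs at least as much as some spanning tree. -/
lemma exists_tree_le_dot (hG : G.Connected) {c x : G.edgeSet → ℝ} (hc : ∀ e, 0 ≤ c e)
    (hx : ∀ e, 0 ≤ x e) (hpart : ∀ W : Finpartition (Finset.univ : Finset V),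
      (W.parts.card : ℝ) - 1 ≤ ∑ e ∈ multicut G W, x e) :
    ∃ F, IsSpanningTree G F ∧ ∑ e ∈ F, c e ≤ dot c x := by
  classical
  obtain ⟨F₀, hF₀⟩ := exists_isSpanningTree hG
  obtain ⟨F, hF, hmin⟩ := Finset.exists_min_image
    (Finset.univ.filter fun F : Finset G.edgeSet => IsSpanningTree G F) (fun F => ∑ e ∈ F, c e)
    ⟨F₀, by simpa using hF₀⟩
  simp only [Finset.mem_filter, Finset.mem_univ, true_and] at hF hmin
  refine ⟨F, hF, ?_⟩
  have h := sum_mul_nonneg_of_levels (fun e => x e - if e ∈ F then 1 else 0) _ c hc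
    (fun r _ => ?_) le_rfl
  · simp only [mul_sub, Finset.sum_sub_distrib, mul_ite, mul_one, mul_zero, Finset.sum_ite_mem,
      Finset.univ_inter] at h
    unfold dot
    linarith
  -- If the tree edges of length at most `r` leave k components, then `x` has mass at least k - 1 on
  -- the longer edges, while the tree has at most k - 1 of them.
  · have h1 := hpart (compPartition (F.filter fun e => c e ≤ r))
    have h2 : ∑ e ∈ multicut G (compPartition (F.filter fun e => c e ≤ r)), x e
        ≤ ∑ e with r < c e, x e := by
      refine Finset.sum_le_sum_of_subset_of_nonneg (fun e he => ?_) fun e _ _ => hx e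
      simpa using lt_of_mem_multicut hF hmin he
    have h3 := card_le_card_add_card_comp (F.filter fun e => c e ≤ r)
    rw [compPartition_parts] at h1
    have h4 := (isSpanningTree_iff.1 hF).2
    have h5 := Finset.card_filter_add_card_filter_not (s := F) (fun e => c e ≤ r)
    have h6 : (F.filter fun e => ¬ c e ≤ r) = Finset.univ.filter (fun e => r < c e) ∩ F := by
      ext e; simp [and_comm]
    rw [h6] at h5
    rw [Finset.sum_sub_distrib, Finset.sum_ite_mem, Finset.sum_const, nsmul_eq_mul, mul_one]
    have h7 : (((Finset.univ.filter fun e => r < c e) ∩ F).card : ℝ) + 1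
        ≤ (Finset.univ.image (comp (F.filter fun e => c e ≤ r))).card := by
      exact_mod_cast (by omega)
    linarith

open Pointwise in
/-- A vector satisfying the partition inequalities dominates a convex combination of spanning
trees. -/
theorem exists_isTreeDistribution (hG : G.Connected) {x : G.edgeSet → ℝ} (hx : ∀ e, 0 ≤ x e)
    (hpart : ∀ W : Finpartition (Finset.univ : Finset V),
      (W.parts.card : ℝ) - 1 ≤ ∑ e ∈ multicut G W, x e) :
    ∃ lam, IsTreeDistribution G x lam := by
  classical
  let L : Set (Finset G.edgeSet → ℝ) :=
    stdSimplex ℝ (Finset G.edgeSet) ∩ {lam | ∀ F, ¬ IsSpanningTree G F → lam F = 0}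
  let Φ : (Finset G.edgeSet → ℝ) →ₗ[ℝ] (G.edgeSet → ℝ) :=
    LinearMap.pi fun e => ∑ F, (if e ∈ F then (1 : ℝ) else 0) • LinearMap.proj F
  have hΦ : ∀ lam e, Φ lam e = ∑ F, lam F * (if e ∈ F then 1 else 0) := by
    intro lam e
    simp only [Φ, LinearMap.pi_apply, LinearMap.sum_apply, LinearMap.smul_apply,
      LinearMap.proj_apply, smul_eq_mul, mul_comm]
  have hLconv : Convex ℝ L := by
    refine (convex_stdSimplex ℝ _).inter fun a ha b hb s t _ _ _ F hF => ?_
    have h1 := ha F hF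
    have h2 := hb F hF
    simp [h1, h2]
  have hLcomp : IsCompact L := by
    refine (isCompact_stdSimplex ℝ _).inter_right ?_
    simp only [Set.ofPred_forall]
    exact isClosed_iInter fun F => isClosed_iInter fun _ =>
      isClosed_eq (continuous_apply F) continuous_const
  -- The dominant of the spanning tree polytope. A functional separating `x` from it has nonnegative
  -- coefficients, since `D` is closed upwards, and thus contradicts `exists_tree_le_dot`.
  let D : Set (G.edgeSet → ℝ) := Φ '' L + Set.Ici (0 : G.edgeSet → ℝ)
  have hDclosed : IsClosed D :=
    isClosed_Ici.add_left_of_isCompact (hLcomp.image Φ.continuous_of_finiteDimensional)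
  have hDconv : Convex ℝ D := (hLconv.linear_image Φ).add (convex_Ici 0)
  have htree : ∀ F, IsSpanningTree G F → ∀ w : G.edgeSet → ℝ, 0 ≤ w →
      (fun e => if e ∈ F then (1 : ℝ) else 0) + w ∈ D := by
    intro F hF w hw
    refine Set.add_mem_add ⟨Pi.single F 1, ⟨single_mem_stdSimplex ℝ F, fun F' hF' => ?_⟩, ?_⟩ hw
    · exact Pi.single_eq_of_ne (fun h => hF' (by rw [h]; exact hF)) _
    · ext e
      rw [hΦ, Finset.sum_eq_single F (fun F' _ h => by rw [Pi.single_eq_of_ne h, zero_mul])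
        (fun h => absurd (Finset.mem_univ F) h), Pi.single_eq_same, one_mul]
  have hxD : x ∈ D := by
    by_contra hxD
    obtain ⟨f, u, hfx, hfD⟩ := geometric_hahn_banach_point_closed hDconv hDclosed hxD
    have hf : ∀ z, f z = dot (fun e => f (Pi.single e 1)) z := by
      intro z
      conv_lhs => rw [pi_eq_sum_univ' z]
      simp only [map_sum, map_smul, smul_eq_mul, dot]
      exact Finset.sum_congr rfl fun e _ => mul_comm _ _
    obtain ⟨F₀, hF₀⟩ := exists_isSpanningTree hG
    have hc : ∀ e, 0 ≤ f (Pi.single e 1) := by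
      intro e
      by_contra! hneg
      set χ : G.edgeSet → ℝ := fun e => if e ∈ F₀ then (1 : ℝ) else 0
      have h0 := hfD _ (htree F₀ hF₀ 0 le_rfl)
      rw [add_zero] at h0
      -- With this multiple of the unit vector the value of `f` drops exactly to `u`.
      have h1 := hfD _ (htree F₀ hF₀ (((f χ - u) / -f (Pi.single e 1)) • Pi.single e 1) (by
        refine smul_nonneg (div_nonneg (by linarith) (by linarith)) ?_
        exact Pi.single_nonneg.2 zero_le_one))
      rw [map_add, map_smul, smul_eq_mul] at h1
      have h2 : (f χ - u) / -f (Pi.single e 1) * f (Pi.single e 1) = -(f χ - u) := by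
        have := hneg.ne
        field_simp
      linarith
    obtain ⟨F, hF, hle⟩ := exists_tree_le_dot hG hc hx hpart
    have h1 := hfD _ (htree F hF 0 le_rfl)
    rw [add_zero, hf] at h1
    rw [hf] at hfx
    have h2 : dot (fun e => f (Pi.single e 1)) (fun e => if e ∈ F then (1 : ℝ) else 0)
        = ∑ e ∈ F, f (Pi.single e 1) := by
      simp [dot, Finset.sum_ite_mem]
    linarith
  obtain ⟨_, ⟨lam, ⟨hlam, hlam0⟩, rfl⟩, w, hw, rfl⟩ := hxD
  refine ⟨lam, hlam.1, fun F hF => ?_, hlam.2, fun e => ?_⟩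
  · by_contra h
    exact hF.ne' (hlam0 F h)
  · rw [← hΦ]
    exact le_add_of_nonneg_right (hw e)

/-! ## The expected length of a parity correction -/

variable {x : G.edgeSet → ℝ} {lam : Finset G.edgeSet → ℝ}

lemma IsTreeDistribution.sum_mono_of_pos (hlam : IsTreeDistribution G x lam)
    {f g : Finset G.edgeSet → ℝ} (h : ∀ F, 0 < lam F → f F ≤ g F) :
    ∑ F, lam F * f F ≤ ∑ F, lam F * g F := by
  refine Finset.sum_le_sum fun F _ => ?_
  rcases (hlam.nonneg F).eq_or_lt with h0 | h0
  · rw [← h0, zero_mul, zero_mul]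
  · exact mul_le_mul_of_nonneg_left (h F h0) h0.le

lemma IsTreeDistribution.sum_mono (hlam : IsTreeDistribution G x lam)
    {f g : Finset G.edgeSet → ℝ} (h : ∀ F, IsSpanningTree G F → f F ≤ g F) :
    ∑ F, lam F * f F ≤ ∑ F, lam F * g F :=
  hlam.sum_mono_of_pos fun F hF => h F (hlam.isSpanningTree F hF)

lemma IsTreeDistribution.sum_const (hlam : IsTreeDistribution G x lam) (a : ℝ) :
    ∑ F, lam F * a = a := by
  rw [← Finset.sum_mul, hlam.sum_eq_one, one_mul]

lemma IsTreeDistribution.sum_card_inter_le (hlam : IsTreeDistribution G x lam)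
    (Q : Finset G.edgeSet) : ∑ F, lam F * (Q ∩ F).card ≤ ∑ e ∈ Q, x e := by
  have h : ∑ F, lam F * ((Q ∩ F).card : ℝ) = ∑ e ∈ Q, ∑ F, lam F * (if e ∈ F then 1 else 0) := by
    rw [Finset.sum_comm]
    refine Finset.sum_congr rfl fun F _ => ?_
    rw [← Finset.mul_sum, Finset.sum_ite_mem, Finset.sum_const, nsmul_eq_mul, mul_one]
  rw [h]
  exact Finset.sum_le_sum fun e _ => hlam.dominated e

lemma one_le_card_cut_inter [Nonempty V] {F : Finset G.edgeSet} (hF : IsSpanningTree G F)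
    {W : Finset V} (hW : W.Nonempty) (hW' : W ≠ Finset.univ) : 1 ≤ (cut G W ∩ F).card :=
  Finset.card_pos.2 (edgeGraph_connected_iff.1 (isSpanningTree_iff.1 hF).1 W hW hW')

/-- The probability that a random tree meets `Q` in an even number of edges. -/
lemma IsTreeDistribution.prob_even_le (hlam : IsTreeDistribution G x lam) {Q : Finset G.edgeSet}
    (hQ : ∀ F, IsSpanningTree G F → 1 ≤ (Q ∩ F).card) :
    ∑ F, lam F * (if Even (Q ∩ F).card then 1 else 0) ≤ ∑ e ∈ Q, x e - 1 := by
  have h1 := hlam.sum_card_inter_le Q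
  have h2 := hlam.sum_mono (f := fun F => (if Even (Q ∩ F).card then (1 : ℝ) else 0) + 1)
    (g := fun F => (Q ∩ F).card) (fun F hF => by
      have := hQ F hF
      split_ifs with h
      · have : 2 ≤ (Q ∩ F).card := by
          obtain ⟨k, hk⟩ := h; omega
        have : (2 : ℝ) ≤ (Q ∩ F).card := by exact_mod_cast this
        linarith
      · have : (1 : ℝ) ≤ (Q ∩ F).card := by exact_mod_cast this
        linarith)
  simp only [mul_add, Finset.sum_add_distrib] at h2
  rw [hlam.sum_const 1] at h2
  linarith

/-- `Pr (Q ∩ 𝓕 = {e})`. -/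
def singleProb (lam : Finset G.edgeSet → ℝ) (Q : Finset G.edgeSet) (e : G.edgeSet) : ℝ :=
  ∑ F, lam F * (if Q ∩ F = {e} then 1 else 0)

lemma IsTreeDistribution.singleProb_nonneg (hlam : IsTreeDistribution G x lam)
    (Q : Finset G.edgeSet) (e : G.edgeSet) : 0 ≤ singleProb lam Q e :=
  Finset.sum_nonneg fun F _ => mul_nonneg (hlam.nonneg F) (by split_ifs <;> norm_num)

/-- The right side is Pr(|Q ∩ 𝓕| = 1), and 2 - |Q ∩ F| is at most the indicator of that event
because every tree meets `Q`. -/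
lemma IsTreeDistribution.le_sum_singleProb (hlam : IsTreeDistribution G x lam)
    {Q : Finset G.edgeSet} (hQ : ∀ F, IsSpanningTree G F → 1 ≤ (Q ∩ F).card) :
    2 - ∑ e ∈ Q, x e ≤ ∑ e ∈ Q, singleProb lam Q e := by
  have h1 := hlam.sum_card_inter_le Q
  unfold singleProb
  rw [Finset.sum_comm]
  simp only [← Finset.mul_sum]
  have h2 := hlam.sum_mono (f := fun F => 2 - ((Q ∩ F).card : ℝ))
    (g := fun F => ∑ e ∈ Q, if Q ∩ F = {e} then (1 : ℝ) else 0) (fun F hF => by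
      have h3 := hQ F hF
      have h4 : ∀ e ∈ Q, (0 : ℝ) ≤ if Q ∩ F = {e} then (1 : ℝ) else 0 := by
        intro e _; split_ifs <;> norm_num
      rcases h3.eq_or_lt with h | h
      · obtain ⟨e, he⟩ := Finset.card_eq_one.1 h.symm
        have heQ : e ∈ Q := Finset.mem_of_mem_inter_left (he ▸ Finset.mem_singleton_self e)
        have := Finset.single_le_sum h4 heQ
        rw [if_pos he] at this
        rw [← h]; push_cast; linarith
      · have : (2 : ℝ) ≤ (Q ∩ F).card := by exact_mod_cast h
        linarith [Finset.sum_nonneg h4])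
  simp only [mul_sub, Finset.sum_sub_distrib] at h2
  rw [hlam.sum_const 2] at h2
  linarith

/-! ### Narrow cuts -/

open Classical in
/-- The cuts of `x`-value smaller than `2`. -/
noncomputable def narrowCuts (x : G.edgeSet → ℝ) : Finset (Finset G.edgeSet) :=
  Finset.univ.filter fun Q =>
    (∃ W : Finset V, W.Nonempty ∧ W ≠ Finset.univ ∧ Q = cut G W) ∧ ∑ e ∈ Q, x e < 2

lemma mem_narrowCuts {Q : Finset G.edgeSet} : Q ∈ narrowCuts x ↔
    (∃ W : Finset V, W.Nonempty ∧ W ≠ Finset.univ ∧ Q = cut G W) ∧ ∑ e ∈ Q, x e < 2 := by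
  simp [narrowCuts]

/-- Distinct cuts have distinct traces on a spanning tree. -/
lemma cut_eq_of_inter_eq [Nonempty V] {F : Finset G.edgeSet} (hF : IsSpanningTree G F)
    {W W' : Finset V} (h : cut G W ∩ F = cut G W' ∩ F) : cut G W = cut G W' := by
  -- The symmetric difference of two cuts is again a cut; missed by a spanning tree, it must be
  -- trivial.
  have h1 : ¬ (cut G (symmDiff W W') ∩ F).Nonempty := by
    rintro ⟨e, he⟩
    obtain ⟨he1, he2⟩ := Finset.mem_inter.1 he
    rw [mem_cut_symmDiff] at he1
    refine he1 ⟨fun h3 => ?_, fun h3 => ?_⟩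
    · exact Finset.mem_of_mem_inter_left (h ▸ Finset.mem_inter.2 ⟨h3, he2⟩)
    · exact Finset.mem_of_mem_inter_left (h ▸ Finset.mem_inter.2 ⟨h3, he2⟩)
  have h2 : symmDiff W W' = ∅ ∨ symmDiff W W' = Finset.univ := by
    by_contra! h3
    exact h1 (edgeGraph_connected_iff.1 (isSpanningTree_iff.1 hF).1 _ h3.1 h3.2)
  ext e
  have h3 := mem_cut_symmDiff W W' e
  rcases h2 with h2 | h2
  · rw [h2, cut_empty] at h3; simpa using h3
  · rw [h2, cut_univ] at h3; simpa using h3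

/-- A narrow cut is odd for `T`, so it meets `X`; if it meets `F` only in `e`, then `e ∈ X`. At most
one cut has the trace {e} on `F`; as the sum runs over edge sets, `W` and its complement count once.
-/
lemma sum_narrowCuts_single_le [Nonempty V] {T : Finset V} (hx : x ∈ P G T)
    {F X : Finset G.edgeSet} (hF : IsSpanningTree G F) (hXF : X ⊆ F) (hX : oddVerts G X = T)
    (e : G.edgeSet) :
    ∑ Q ∈ narrowCuts x, (if Q ∩ F = {e} then (1 : ℝ) else 0) ≤ if e ∈ X then 1 else 0 := by
  rw [Finset.sum_boole]
  have hmem : ∀ Q ∈ (narrowCuts x).filter fun Q => Q ∩ F = {e}, e ∈ X := by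
    intro Q hQ
    obtain ⟨hQ, hQe⟩ := Finset.mem_filter.1 hQ
    obtain ⟨⟨W, hW, hW', rfl⟩, hlt⟩ := mem_narrowCuts.1 hQ
    have hodd : Odd (cut G W ∩ X).card := by
      rw [odd_cut_inter_iff, hX, ← Nat.not_even_iff_odd]
      exact fun h => absurd (hx.1 W hW hW' h) (not_le.2 hlt)
    obtain ⟨f, hf⟩ := Finset.card_pos.1 hodd.pos
    obtain ⟨hf1, hf2⟩ := Finset.mem_inter.1 hf
    have : f ∈ ({e} : Finset G.edgeSet) := hQe ▸ Finset.mem_inter.2 ⟨hf1, hXF hf2⟩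
    rwa [← Finset.mem_singleton.1 this]
  have hcard : ((narrowCuts x).filter fun Q => Q ∩ F = {e}).card ≤ 1 := by
    refine Finset.card_le_one.2 fun Q hQ Q' hQ' => ?_
    obtain ⟨hQ, hQe⟩ := Finset.mem_filter.1 hQ
    obtain ⟨⟨W, hW, hW', rfl⟩, -⟩ := mem_narrowCuts.1 hQ
    obtain ⟨hQ', hQe'⟩ := Finset.mem_filter.1 hQ'
    obtain ⟨⟨W', -, -, rfl⟩, -⟩ := mem_narrowCuts.1 hQ'
    exact cut_eq_of_inter_eq hF (hQe.trans hQe'.symm)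
  split_ifs with h
  · exact_mod_cast hcard
  · rw [Finset.card_eq_zero.2 (Finset.eq_empty_of_forall_notMem fun Q hQ => h (hmem Q hQ))]
    simp

/-- The multiplier of `singleProb lam Q` in the parity correction, for a cut of value `z`. -/
noncomputable def correction (z : ℝ) : ℝ := max 0 ((7 - 4 * z) / (9 * (2 - z)))

/-- After clearing denominators this is (2z - 3)² ≥ 0, with equality at z = 3/2. The factor z - 1
bounds the probability that the cut needs repair. -/
lemma correction_mul_le {z : ℝ} (h1 : 1 ≤ z) (h2 : z < 2) : (z - 1) * correction z ≤ 1 / 9 := by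
  rw [correction, mul_max_of_nonneg _ _ (by linarith)]
  refine max_le (by norm_num) ?_
  rw [← mul_div_assoc, div_le_div_iff₀ (by linarith) (by norm_num)]
  nlinarith [sq_nonneg (2 * z - 3)]

/-- The left side is the deficit 1 - 2/9 - 4z/9 of a narrow cut met at least twice by the tree. -/
lemma le_correction_mul {z s : ℝ} (h2 : z < 2) (hs : 2 - z ≤ s) :
    (7 - 4 * z) / 9 ≤ correction z * s := by
  have h0 : 0 ≤ correction z := le_max_left _ _
  calc (7 - 4 * z) / 9 = (7 - 4 * z) / (9 * (2 - z)) * (2 - z) := by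
        have : (2 - z) ≠ 0 := by linarith
        field_simp
    _ ≤ correction z * (2 - z) := mul_le_mul_of_nonneg_right (le_max_right _ _) (by linarith)
    _ ≤ correction z * s := mul_le_mul_of_nonneg_left hs h0

lemma tau_le {c : G.edgeSet → ℝ} (hc : ∀ e, 0 ≤ c e) {T : Finset V} {J : Finset G.edgeSet}
    (hJ : IsTJoin G T J) : tau G T c ≤ ∑ e ∈ J, c e :=
  csInf_le ⟨0, by rintro r ⟨J, -, rfl⟩; exact Finset.sum_nonneg fun e _ => hc e⟩ ⟨J, hJ, rfl⟩

/-- The vector used to correct the parity of the tree `F`. -/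
noncomputable def correctionVector (x : G.edgeSet → ℝ) (lam : Finset G.edgeSet → ℝ)
    (F : Finset G.edgeSet) (e : G.edgeSet) : ℝ :=
  1 / 9 * (if e ∈ F then 1 else 0) + 4 / 9 * x e + ∑ Q ∈ narrowCuts x,
    (if Even (Q ∩ F).card then 1 else 0) * correction (∑ e ∈ Q, x e) * singleProb lam Q e

lemma correctionVector_term_nonneg (hlam : IsTreeDistribution G x lam) (F Q : Finset G.edgeSet)
    (e : G.edgeSet) : 0 ≤ (if Even (Q ∩ F).card then (1 : ℝ) else 0) *
      correction (∑ e ∈ Q, x e) * singleProb lam Q e :=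
  mul_nonneg (mul_nonneg (by split_ifs <;> norm_num) (le_max_left _ _))
    (hlam.singleProb_nonneg Q e)

lemma one_le_correctionVector_cut [Nonempty V] {T : Finset V} (hT : Even T.card)
    (hx : x ∈ P G T) (hlam : IsTreeDistribution G x lam) {F : Finset G.edgeSet}
    (hF : IsSpanningTree G F) {W : Finset V} (hW : Odd (W ∩ symmDiff (oddVerts G F) T).card) :
    1 ≤ ∑ e ∈ cut G W, correctionVector x lam F e := by
  have hne : W.Nonempty := by
    rw [Finset.nonempty_iff_ne_empty]
    rintro rfl
    simp at hW
  have huniv : W ≠ Finset.univ := by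
    rintro rfl
    rw [Finset.univ_inter, odd_card_symmDiff] at hW
    have := even_card_oddVerts F
    grind
  have hF1 := one_le_card_cut_inter hF hne huniv
  have hsum : ∑ e ∈ cut G W, correctionVector x lam F e = 1 / 9 * ((cut G W ∩ F).card : ℝ)
      + 4 / 9 * ∑ e ∈ cut G W, x e + ∑ Q ∈ narrowCuts x, ∑ e ∈ cut G W,
        (if Even (Q ∩ F).card then 1 else 0) * correction (∑ e ∈ Q, x e) * singleProb lam Q e := by
    simp only [correctionVector, Finset.sum_add_distrib, ← Finset.mul_sum]
    rw [Finset.sum_ite_mem, Finset.sum_const, nsmul_eq_mul, mul_one, Finset.sum_comm]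
    simp only [Finset.mul_sum]
  have hterm : ∀ Q ∈ narrowCuts x, 0 ≤ ∑ e ∈ cut G W, (if Even (Q ∩ F).card then (1 : ℝ) else 0) *
      correction (∑ e ∈ Q, x e) * singleProb lam Q e :=
    fun Q _ => Finset.sum_nonneg fun e _ => correctionVector_term_nonneg hlam F Q e
  rw [hsum]
  -- For a narrow cut, `W` is odd for `T` and so even for `T_F`: the tree contributes 2/9 and the
  -- cut's own repair term covers the deficit. Otherwise 1/9 + 8/9 suffices.
  by_cases hnarrow : ∑ e ∈ cut G W, x e < 2
  · have hmem : cut G W ∈ narrowCuts x := mem_narrowCuts.2 ⟨⟨W, hne, huniv, rfl⟩, hnarrow⟩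
    have hoddT : Odd (W ∩ T).card := by
      rw [← Nat.not_even_iff_odd]
      exact fun h => absurd (hx.1 W hne huniv h) (not_le.2 hnarrow)
    have heven : Even (cut G W ∩ F).card := by
      rw [← Nat.not_odd_iff_even, odd_cut_inter_iff]
      have hdist : W ∩ symmDiff (oddVerts G F) T
          = symmDiff (W ∩ oddVerts G F) (W ∩ T) := inf_symmDiff_distrib_left _ _ _
      rw [hdist, odd_card_symmDiff] at hW
      tauto
    have h2 : (2 : ℝ) ≤ (cut G W ∩ F).card := by
      have : 2 ≤ (cut G W ∩ F).card := by
        obtain ⟨k, hk⟩ := heven; omega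
      exact_mod_cast this
    have h3 := Finset.single_le_sum hterm hmem
    simp only [← Finset.mul_sum, if_pos heven, one_mul] at h3
    have h4 := le_correction_mul hnarrow
      (hlam.le_sum_singleProb fun F hF => one_le_card_cut_inter hF hne huniv)
    simp only [← Finset.mul_sum] at *
    linarith
  · have h2 : (1 : ℝ) ≤ (cut G W ∩ F).card := by exact_mod_cast hF1
    have h3 := Finset.sum_nonneg hterm
    linarith

/-- The expected value of the correction vector plus the expected `T_F ∆ T`-join inside the tree. -/
lemma expected_correction_le [Nonempty V] {T : Finset V} (hx : x ∈ P G T)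
    (hlam : IsTreeDistribution G x lam) {X : Finset G.edgeSet → Finset G.edgeSet}
    (hX : ∀ F, IsSpanningTree G F → X F ⊆ F ∧ oddVerts G (X F) = T) (e : G.edgeSet) :
    ∑ F, lam F * (9 / 10 * correctionVector x lam F e
      + 1 / 10 * if e ∈ F \ X F then 1 else 0) ≤ 3 / 5 * x e := by
  set p := ∑ F, lam F * (if e ∈ X F then 1 else 0) with hp
  set q := ∑ F, lam F * (if e ∈ F \ X F then 1 else 0) with hq
  set t := ∑ F, lam F * (if e ∈ F then 1 else 0) with ht
  have htx : t ≤ x e := hlam.dominated e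
  -- The sets `X F` and `F \ X F` are disjoint parts of `F`.
  have hpq : p + q ≤ t := by
    rw [hp, hq, ← Finset.sum_add_distrib]
    simp only [← mul_add]
    refine hlam.sum_mono fun F hF => ?_
    have := @(hX F hF).1 e
    by_cases h1 : e ∈ X F
    · simp [h1, this h1]
    · simp [h1]
  have hcorr : ∑ F, lam F * ∑ Q ∈ narrowCuts x, (if Even (Q ∩ F).card then 1 else 0) *
      correction (∑ e ∈ Q, x e) * singleProb lam Q e ≤ 1 / 9 * p := by
    calc ∑ F, lam F * ∑ Q ∈ narrowCuts x, (if Even (Q ∩ F).card then 1 else 0) *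
          correction (∑ e ∈ Q, x e) * singleProb lam Q e
        = ∑ Q ∈ narrowCuts x, (∑ F, lam F * (if Even (Q ∩ F).card then 1 else 0)) *
          correction (∑ e ∈ Q, x e) * singleProb lam Q e := by
          simp only [Finset.mul_sum, Finset.sum_mul]
          rw [Finset.sum_comm]
          simp only [mul_assoc]
      _ ≤ ∑ Q ∈ narrowCuts x, 1 / 9 * singleProb lam Q e := by
          refine Finset.sum_le_sum fun Q hQ => ?_
          refine mul_le_mul_of_nonneg_right ?_ (hlam.singleProb_nonneg Q e)
          obtain ⟨⟨W, hW, hW', rfl⟩, hlt⟩ := mem_narrowCuts.1 hQ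
          have h1 := hlam.prob_even_le fun F hF => one_le_card_cut_inter hF hW hW'
          have h0 : 0 ≤ ∑ F, lam F * (if Even (cut G W ∩ F).card then (1 : ℝ) else 0) :=
            Finset.sum_nonneg fun F _ => mul_nonneg (hlam.nonneg F) (by split_ifs <;> norm_num)
          exact (mul_le_mul_of_nonneg_right h1 (le_max_left _ _)).trans
            (correction_mul_le (by linarith) hlt)
      _ = 1 / 9 * ∑ F, lam F * ∑ Q ∈ narrowCuts x, (if Q ∩ F = {e} then 1 else 0) := by
          rw [← Finset.mul_sum]
          simp only [singleProb, Finset.mul_sum]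
          rw [Finset.sum_comm]
      _ ≤ 1 / 9 * p := by
          refine mul_le_mul_of_nonneg_left (hlam.sum_mono fun F hF => ?_) (by norm_num)
          exact sum_narrowCuts_single_le hx hF (hX F hF).1 (hX F hF).2 e
  have hsplit : ∑ F, lam F * (9 / 10 * correctionVector x lam F e
      + 1 / 10 * if e ∈ F \ X F then 1 else 0)
      = 1 / 10 * t + 2 / 5 * x e + 9 / 10 * (∑ F, lam F * ∑ Q ∈ narrowCuts x,
        (if Even (Q ∩ F).card then 1 else 0) * correction (∑ e ∈ Q, x e) * singleProb lam Q e)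
        + 1 / 10 * q := by
    rw [ht, hq, Finset.mul_sum, Finset.mul_sum, Finset.mul_sum, ← hlam.sum_const (2 / 5 * x e),
      ← Finset.sum_add_distrib, ← Finset.sum_add_distrib, ← Finset.sum_add_distrib]
    refine Finset.sum_congr rfl fun F _ => ?_
    simp only [correctionVector]
    ring
  rw [hsplit]
  linarith

lemma dot_add (c u v : G.edgeSet → ℝ) (a b : ℝ) :
    dot c (fun e => a * u e + b * v e) = a * dot c u + b * dot c v := by
  simp only [dot, Finset.mul_sum, ← Finset.sum_add_distrib]
  exact Finset.sum_congr rfl fun e _ => by ring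

lemma dot_indicator (c : G.edgeSet → ℝ) (F : Finset G.edgeSet) :
    dot c (fun e => if e ∈ F then 1 else 0) = ∑ e ∈ F, c e := by
  simp [dot, Finset.sum_ite_mem]

lemma sum_mul_dot (c : G.edgeSet → ℝ) (u : Finset G.edgeSet → G.edgeSet → ℝ) :
    ∑ F, lam F * dot c (u F) = dot c (fun e => ∑ F, lam F * u F e) := by
  simp only [dot, Finset.mul_sum]
  rw [Finset.sum_comm]
  exact Finset.sum_congr rfl fun e _ => Finset.sum_congr rfl fun F _ => by ring

lemma dot_mono {c u v : G.edgeSet → ℝ} (hc : ∀ e, 0 ≤ c e) (h : ∀ e, u e ≤ v e) :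
    dot c u ≤ dot c v :=
  Finset.sum_le_sum fun e _ => mul_le_mul_of_nonneg_left (h e) (hc e)

/-- The expected length of a shortest parity correction. -/
theorem expectation_tau_le [Nonempty V] {c : G.edgeSet → ℝ} (hc : ∀ e, 0 ≤ c e) {T : Finset V}
    (hT : Even T.card) (hx : x ∈ P G T) (hlam : IsTreeDistribution G x lam) :
    expectation lam (fun F => tau G (symmDiff (oddVerts G F) T) c) ≤ 3 / 5 * dot c x := by
  have hX : ∀ F : Finset G.edgeSet, ∃ X : Finset G.edgeSet,
      IsSpanningTree G F → X ⊆ F ∧ oddVerts G X = T := by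
    intro F
    by_cases hF : IsSpanningTree G F
    · obtain ⟨X, h⟩ := exists_join_of_connected (isSpanningTree_iff.1 hF).1 hT
      exact ⟨X, fun _ => h⟩
    · exact ⟨∅, fun h => absurd h hF⟩
  choose X hX using hX
  have hx0 : ∀ e, 0 ≤ x e := fun e => (hx.2.2 e).1
  have hle : ∀ F, IsSpanningTree G F → tau G (symmDiff (oddVerts G F) T) c ≤
      dot c (fun e => 9 / 10 * correctionVector x lam F e
        + 1 / 10 * if e ∈ F \ X F then 1 else 0) := by
    intro F hF
    have hjoin : IsTJoin G (symmDiff (oddVerts G F) T) (F \ X F) := by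
      rw [IsTJoin, ← symmDiff_of_ge (hX F hF).1, oddVerts_symmDiff, (hX F hF).2]
    obtain ⟨J, hJ, hJle⟩ := exists_tjoin_le_dot hc (y := correctionVector x lam F) (fun e => by
        refine add_nonneg (add_nonneg ?_ (mul_nonneg (by norm_num) (hx0 e)))
          (Finset.sum_nonneg fun Q _ => correctionVector_term_nonneg hlam F Q e)
        split_ifs <;> norm_num) ⟨_, hjoin⟩
      (fun W hW => one_le_correctionVector_cut hT hx hlam hF hW)
    have h1 := (tau_le hc hJ).trans hJle
    have h2 := tau_le hc hjoin
    rw [← dot_indicator] at h2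
    -- The minimum is below any average of the two bounds; weights 9/10 and 1/10 give `X F` (through
    -- the factor 1/9) and `F \ X F` the same coefficient 1/10.
    rw [dot_add]
    linarith
  calc expectation lam (fun F => tau G (symmDiff (oddVerts G F) T) c)
      ≤ ∑ F, lam F * dot c (fun e => 9 / 10 * correctionVector x lam F e
        + 1 / 10 * if e ∈ F \ X F then 1 else 0) := hlam.sum_mono hle
    _ = _ := sum_mul_dot c _
    _ ≤ dot c (fun e => 3 / 5 * x e) := dot_mono hc fun e => expected_correction_le hx hlam hX e
    _ = 3 / 5 * dot c x := by
      simp only [dot, Finset.mul_sum]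
      exact Finset.sum_congr rfl fun e _ => by ring

/-! ## Tours and the Best-of-Many Christofides algorithm -/

lemma card_comp_le_union (A B : Finset G.edgeSet) :
    (Finset.univ.image (comp A)).card ≤ (Finset.univ.image (comp (B ∪ A))).card + B.card := by
  induction B using Finset.induction_on with
  | empty => simp
  | insert e B he ih =>
    have := card_comp_le_insert (B ∪ A) e
    rw [Finset.insert_union, Finset.card_insert_of_notMem he]
    omega

/-- A connected set of edges satisfies the partition inequalities. -/
lemma card_parts_le [Nonempty V] {S : Finset G.edgeSet} (hS : (edgeGraph S).Connected)
    (W : Finpartition (Finset.univ : Finset V)) :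
    W.parts.card ≤ (multicut G W ∩ S).card + 1 := by
  have hmem : ∀ A ∈ W.parts, ∃ a, a ∈ A := fun A hA => W.nonempty_of_mem_parts hA
  choose! r hr using hmem
  have hsub : ∀ A ∈ W.parts, ∀ b ∈ comp (S \ multicut G W) (r A), b ∈ A := by
    intro A hA b hb
    refine mem_of_reachable_of_cut ?_ (mem_comp.1 hb) (hr A hA)
    ext e
    simp only [Finset.mem_inter, Finset.mem_sdiff, Finset.notMem_empty, iff_false, not_and,
      not_not]
    exact fun he _ => Finset.mem_biUnion.2 ⟨A, hA, he⟩
  -- Without the multicut no component leaves its class, so there is at least one per class. Each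
  -- edge put back merges at most two, and in the end one component is left.
  have h1 : W.parts.card ≤ (Finset.univ.image (comp (S \ multicut G W))).card := by
    refine Finset.card_le_card_of_injOn (fun A => comp (S \ multicut G W) (r A))
      (fun A _ => Finset.mem_image_of_mem _ (Finset.mem_univ _)) fun A hA B hB hAB => ?_
    refine W.eq_of_mem_parts hA hB (a := r B) (hsub A hA _ ?_) (hr B hB)
    have : comp (S \ multicut G W) (r A) = comp (S \ multicut G W) (r B) := hAB
    rw [this]
    exact self_mem_comp _ _
  have h2 := card_comp_le_union (S \ multicut G W) (multicut G W ∩ S)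
  have h3 : multicut G W ∩ S ∪ S \ multicut G W = S := by
    rw [Finset.inter_comm, Finset.union_comm, Finset.sdiff_union_inter]
  have h4 : (Finset.univ.image (comp S)).card ≤ 1 := by
    refine Finset.card_le_one.2 fun A hA B hB => ?_
    obtain ⟨a, -, rfl⟩ := Finset.mem_image.1 hA
    obtain ⟨b, -, rfl⟩ := Finset.mem_image.1 hB
    exact comp_eq (mem_comp.2 (hS.preconnected b a))
  rw [h3] at h2
  omega

lemma card_parts_sub_one_le [Nonempty V] {S : Finset G.edgeSet} (hS : (edgeGraph S).Connected)
    (hx : ∀ e, 0 ≤ x e) (hxS : ∀ e ∈ S, 1 ≤ x e) (W : Finpartition (Finset.univ : Finset V)) :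
    (W.parts.card : ℝ) - 1 ≤ ∑ e ∈ multicut G W, x e := by
  have h1 : (W.parts.card : ℝ) ≤ (multicut G W ∩ S).card + 1 := by
    exact_mod_cast card_parts_le hS W
  have h2 : ((multicut G W ∩ S).card : ℝ) ≤ ∑ e ∈ multicut G W ∩ S, x e := by
    rw [Finset.card_eq_sum_ones]
    push_cast
    exact Finset.sum_le_sum fun e he => hxS e (Finset.mem_inter.1 he).2
  have h3 : ∑ e ∈ multicut G W ∩ S, x e ≤ ∑ e ∈ multicut G W, x e :=
    Finset.sum_le_sum_of_subset_of_nonneg Finset.inter_subset_left fun e _ _ => hx e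
  linarith

/-- The set of edges of a multiset. -/
def edgeSupport (H : G.edgeSet → ℕ) : Finset G.edgeSet := Finset.univ.filter fun e => H e ≠ 0

lemma mem_edgeSupport {H : G.edgeSet → ℕ} {e : G.edgeSet} : e ∈ edgeSupport H ↔ H e ≠ 0 := by
  simp [edgeSupport]

lemma edgeGraph_edgeSupport (H : G.edgeSet → ℕ) : edgeGraph (edgeSupport H) =
    SimpleGraph.fromEdgeSet {a : Sym2 V | ∃ e, H e ≠ 0 ∧ (e : Sym2 V) = a} := by
  simp [edgeGraph, edgeSupport]

lemma IsTTour.connected_edgeGraph {T : Finset V} {H : G.edgeSet → ℕ} (hH : IsTTour G T H) :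
    (edgeGraph (edgeSupport H)).Connected := by
  rw [edgeGraph_edgeSupport]; exact hH.connected

lemma one_le_cast_of_mem_edgeSupport {H : G.edgeSet → ℕ} {e : G.edgeSet}
    (he : e ∈ edgeSupport H) : (1 : ℝ) ≤ H e := by
  exact_mod_cast Nat.one_le_iff_ne_zero.2 (mem_edgeSupport.1 he)

/-- The multiplicity vector of a `T`-tour belongs to `P G T`. -/
lemma IsTTour.mem_P {T : Finset V} {K : G.edgeSet → ℕ} (hK : IsTTour G T K) :
    (fun e => (K e : ℝ)) ∈ P G T := by
  have hconn := hK.connected_edgeGraph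
  have := hconn.nonempty
  refine ⟨fun W hW hW' heven => ?_, fun W => ?_, fun e => ⟨Nat.cast_nonneg _, ?_⟩⟩
  · obtain ⟨e, he⟩ := edgeGraph_connected_iff.1 hconn W hW hW'
    obtain ⟨he1, he2⟩ := Finset.mem_inter.1 he
    -- By connectedness the cut is not empty, and by parity it is even, so it has at least two
    -- edges.
    have h1 : K e ≤ ∑ e ∈ cut G W, K e :=
      Finset.single_le_sum (fun e _ => Nat.zero_le _) he1
    have h2 := mem_edgeSupport.1 he2
    have h3 : Even (∑ e ∈ cut G W, K e) := by
      rw [← Nat.not_odd_iff_even, odd_sum_cut_iff hK.parity, Nat.not_odd_iff_even]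
      exact heven
    have h4 : 2 ≤ ∑ e ∈ cut G W, K e := by
      obtain ⟨k, hk⟩ := h3; omega
    show (2 : ℝ) ≤ ∑ e ∈ cut G W, (K e : ℝ)
    exact_mod_cast h4
  · exact card_parts_sub_one_le hconn (fun e => Nat.cast_nonneg _)
      (fun e he => one_le_cast_of_mem_edgeSupport he) W
  · show (K e : ℝ) ≤ 2
    exact_mod_cast hK.le_two e

/-- Nonemptiness of the polytope, which together with compactness yields an optimum. -/
lemma two_mem_P (hG : G.Connected) (T : Finset V) : (fun _ => 2) ∈ P G T := by
  have := hG.nonempty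
  have hconn : (edgeGraph (Finset.univ : Finset G.edgeSet)).Connected := by
    rwa [edgeGraph_univ]
  refine ⟨fun W hW hW' _ => ?_, fun W => ?_, fun e => ⟨by norm_num, le_rfl⟩⟩
  · obtain ⟨e, he⟩ := edgeGraph_connected_iff.1 hconn W hW hW'
    exact Finset.single_le_sum (f := fun _ => (2 : ℝ)) (fun _ _ => by norm_num)
      (Finset.mem_inter.1 he).1
  · exact card_parts_sub_one_le hconn (fun _ => by norm_num) (fun _ _ => by norm_num) W

lemma isCompact_P (T : Finset V) : IsCompact (P G T) := by
  have h : P G T = Set.Icc 0 2 ∩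
      ((⋂ (W : Finset V) (_ : W.Nonempty) (_ : W ≠ Finset.univ) (_ : Even (W ∩ T).card),
        {x : G.edgeSet → ℝ | 2 ≤ ∑ e ∈ cut G W, x e}) ∩
      ⋂ W : Finpartition (Finset.univ : Finset V),
        {x : G.edgeSet → ℝ | (W.parts.card : ℝ) - 1 ≤ ∑ e ∈ multicut G W, x e}) := by
    ext x
    simp only [P, Set.mem_ofPred_eq, Set.mem_inter_iff, Set.mem_iInter, Set.mem_Icc, Pi.le_def,
      Pi.ofNat_apply, forall_and]
    tauto
  rw [h]
  refine isCompact_Icc.inter_right (IsClosed.inter ?_ ?_)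
  · refine isClosed_iInter fun W => isClosed_iInter fun _ => isClosed_iInter fun _ =>
      isClosed_iInter fun _ => isClosed_le continuous_const ?_
    fun_prop
  · refine isClosed_iInter fun W => isClosed_le continuous_const ?_
    fun_prop

lemma exists_isOptimal (hG : G.Connected) (T : Finset V) (c : G.edgeSet → ℝ) :
    ∃ x, IsOptimal G T c x := by
  obtain ⟨x, hx, hmin⟩ := (isCompact_P T).exists_isMinOn ⟨_, two_mem_P hG T⟩
    (f := dot c) (by unfold dot; fun_prop)
  exact ⟨x, hx, fun y hy => hmin hy⟩

/-! ### Existence and guarantee of the output -/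

lemma multiLength_multiAdd (c : G.edgeSet → ℝ) (A B : Finset G.edgeSet) :
    multiLength c (multiAdd A B) = ∑ e ∈ A, c e + ∑ e ∈ B, c e := by
  rw [← dot_indicator, ← dot_indicator]
  simp only [multiLength, multiAdd, dot, ← Finset.sum_add_distrib]
  refine Finset.sum_congr rfl fun e _ => ?_
  push_cast
  ring

lemma even_card_symmDiff_oddVerts {T : Finset V} (hT : Even T.card) (F : Finset G.edgeSet) :
    Even (symmDiff (oddVerts G F) T).card := by
  rw [← Nat.not_odd_iff_even, odd_card_symmDiff]
  have := even_card_oddVerts F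
  grind

lemma exists_output (hG : G.Connected) {T : Finset V} (hT : Even T.card) (c : G.edgeSet → ℝ) :
    ∃ H, IsBestOfManyOutput G T c H := by
  classical
  obtain ⟨x, hx⟩ := exists_isOptimal hG T c
  obtain ⟨lam, hlam⟩ := exists_isTreeDistribution hG (fun e => (hx.1.2.2 e).1) hx.1.2.1
  have hJ : ∀ F : Finset G.edgeSet, ∃ J, IsShortestTJoin G (symmDiff (oddVerts G F) T) c J := by
    intro F
    have hconn : (edgeGraph (Finset.univ : Finset G.edgeSet)).Connected := by
      rwa [edgeGraph_univ]
    obtain ⟨J, -, hJ⟩ := exists_join_of_connected hconn (even_card_symmDiff_oddVerts hT F)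
    exact exists_shortest ⟨J, hJ⟩ c
  choose J hJ using hJ
  have hne : (Finset.univ.filter fun F => 0 < lam F).Nonempty := by
    obtain ⟨F, -, hF⟩ := Finset.exists_ne_zero_of_sum_ne_zero
      (s := Finset.univ) (f := lam) (by rw [hlam.sum_eq_one]; exact one_ne_zero)
    exact ⟨F, by simpa using lt_of_le_of_ne (hlam.nonneg F) hF.symm⟩
  obtain ⟨F, hF, hmin⟩ := Finset.exists_min_image _
    (fun F => multiLength c (multiAdd F (J F))) hne
  simp only [Finset.mem_filter, Finset.mem_univ, true_and] at hF hmin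
  exact ⟨_, x, lam, J, hx, hlam, fun F _ => hJ F, F, hF, rfl, hmin⟩

lemma isTTour_multiAdd {T : Finset V} {F J : Finset G.edgeSet} (hF : IsSpanningTree G F)
    (hJ : IsTJoin G (symmDiff (oddVerts G F) T) J) : IsTTour G T (multiAdd F J) := by
  refine ⟨fun e => ?_, fun v => ?_, ?_⟩
  · simp only [multiAdd]; split_ifs <;> omega
  · simp only [multiAdd, Finset.sum_add_distrib, sum_indicator]
    have h1 : v ∈ oddVerts G J ↔ v ∈ symmDiff (oddVerts G F) T := by rw [hJ]
    rw [Finset.mem_symmDiff, mem_oddVerts, mem_oddVerts] at h1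
    rw [Nat.odd_add, ← Nat.not_odd_iff_even]
    tauto
  · rw [← edgeGraph_edgeSupport]
    refine (isSpanningTree_iff.1 hF).1.mono (edgeGraph_mono fun e he => ?_)
    rw [mem_edgeSupport]
    simp [multiAdd, he]

lemma sum_le_tau {c : G.edgeSet → ℝ} {T : Finset V} {J : Finset G.edgeSet}
    (hJ : IsShortestTJoin G T c J) : ∑ e ∈ J, c e ≤ tau G T c := by
  refine le_csInf ⟨_, J, hJ.1, rfl⟩ ?_
  rintro r ⟨J', hJ', rfl⟩
  exact hJ.2 J' hJ'

lemma IsTreeDistribution.sum_length_le (hlam : IsTreeDistribution G x lam) {c : G.edgeSet → ℝ}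
    (hc : ∀ e, 0 ≤ c e) : ∑ F, lam F * ∑ e ∈ F, c e ≤ dot c x := by
  simp only [← dot_indicator]
  rw [sum_mul_dot]
  exact dot_mono hc hlam.dominated

/-- The guarantee for the output of Best-of-Many Christofides. -/
theorem IsBestOfManyOutput.isTTour_and_le [Nonempty V] {c : G.edgeSet → ℝ} (hc : ∀ e, 0 ≤ c e)
    {T : Finset V} (hT : Even T.card) {H : G.edgeSet → ℕ} (hH : IsBestOfManyOutput G T c H) :
    IsTTour G T H ∧ (∀ x, IsOptimal G T c x → multiLength c H ≤ 8 / 5 * dot c x) ∧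
      ∀ K, IsTTour G T K → multiLength c H ≤ 8 / 5 * multiLength c K := by
  obtain ⟨x, lam, J, hx, hlam, hJ, F, hF, rfl, hmin⟩ := hH
  have hle : multiLength c (multiAdd F (J F)) ≤ 8 / 5 * dot c x := by
    -- The minimum over the trees of the distribution is at most the expectation.
    calc multiLength c (multiAdd F (J F))
        = ∑ F', lam F' * multiLength c (multiAdd F (J F)) := (hlam.sum_const _).symm
      _ ≤ ∑ F', lam F' * (∑ e ∈ F', c e + tau G (symmDiff (oddVerts G F') T) c) := by
          refine hlam.sum_mono_of_pos fun F' hF' => (hmin F' hF').trans ?_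
          rw [multiLength_multiAdd]
          exact add_le_add le_rfl (sum_le_tau (hJ F' hF'))
      _ = ∑ F', lam F' * ∑ e ∈ F', c e
          + expectation lam (fun F' => tau G (symmDiff (oddVerts G F') T) c) := by
          simp only [mul_add, Finset.sum_add_distrib, expectation]
      _ ≤ dot c x + 3 / 5 * dot c x :=
          add_le_add (hlam.sum_length_le hc) (expectation_tau_le hc hT hx.1 hlam)
      _ = 8 / 5 * dot c x := by ring
  refine ⟨isTTour_multiAdd (hlam.isSpanningTree F hF) (hJ F hF).1, fun y hy => ?_, fun K hK => ?_⟩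
  · linarith [hx.2 y hy.1]
  · have h1 := hx.2 _ hK.mem_P
    have h2 : dot c (fun e => (K e : ℝ)) = multiLength c K := rfl
    linarith

/-! ## Eulerian walks and shortcuts -/

open SimpleGraph


lemma walkMult_nil (s : V) (e : G.edgeSet) : walkMult (Walk.nil : G.Walk s s) e = 0 := by
  simp [walkMult]

lemma walkMult_cons {u v t : V} (h : G.Adj u v) (p : G.Walk v t) (e : G.edgeSet) :
    walkMult (Walk.cons h p) e = walkMult p e + if e = ⟨s(u, v), h⟩ then 1 else 0 := by
  simp only [walkMult, Walk.edges_cons, List.count_cons, beq_iff_eq]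
  congr 1
  refine if_congr ?_ rfl rfl
  rw [Subtype.ext_iff, eq_comm]

lemma walkMult_append {u v t : V} (p : G.Walk u v) (q : G.Walk v t) (e : G.edgeSet) :
    walkMult (p.append q) e = walkMult p e + walkMult q e := by
  simp [walkMult, Walk.edges_append]

lemma sum_walkMult {u v : V} (p : G.Walk u v) : ∑ e, walkMult p e = p.length := by
  induction p with
  | nil => simp [walkMult_nil]
  | cons h p ih =>
    simp only [walkMult_cons, Finset.sum_add_distrib, ih, Finset.sum_ite_eq', Finset.mem_univ,
      if_true, Walk.length_cons]

lemma symmDiff_singleton_parity {u v t : V} {h : G.Adj u v} {H : G.edgeSet → ℕ}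
    (hH : ∀ x, x ∈ symmDiff ({v} : Finset V) {t} ↔ Odd (∑ e ∈ cut G {x}, H e)) (x : V) :
    x ∈ symmDiff ({u} : Finset V) {t} ↔
      Odd (∑ e ∈ cut G {x}, (H e + if e = ⟨s(u, v), h⟩ then 1 else 0)) := by
  have hne := h.ne
  rw [Finset.sum_add_distrib, Finset.sum_ite_eq', ← symmDiff_trans {u} {v} {t},
    Finset.mem_symmDiff, hH, Nat.odd_add]
  simp only [mem_cut_singleton, Sym2.mem_iff, Finset.mem_symmDiff, Finset.mem_singleton]
  by_cases h1 : x = u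
  · subst h1
    simp [hne]
  · by_cases h2 : x = v
    · subst h2
      simp [h1]
    · simp [h1, h2]

lemma walkMult_parity {s t : V} (w : G.Walk s t) :
    ∀ v, v ∈ symmDiff ({s} : Finset V) {t} ↔ Odd (∑ e ∈ cut G {v}, walkMult w e) := by
  induction w with
  | nil => intro v; simp [walkMult_nil]
  | cons h p ih =>
    simp only [walkMult_cons]
    exact symmDiff_singleton_parity ih

/-- The ends of an odd-degree pair of a multiset of edges are joined by a path in it. -/
lemma exists_walk_le {H : G.edgeSet → ℕ} {s t : V}
    (hH : ∀ v, v ∈ symmDiff ({s} : Finset V) {t} ↔ Odd (∑ e ∈ cut G {v}, H e)) :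
    ∃ p : G.Walk s t, ∀ e, walkMult p e ≤ H e := by
  classical
  -- Edges of odd multiplicity already form the join; a path among them uses each at most once,
  -- hence within `H`.
  have hodd : oddVerts G (Finset.univ.filter fun e => Odd (H e)) = symmDiff {s} {t} := by
    ext v
    rw [hH, mem_oddVerts, Finset.odd_sum_iff_odd_card_odd]
    congr! 2
    ext e
    simp
  obtain ⟨p, hp⟩ := (reachable_of_join subset_rfl hodd).exists_isPath
  have hle : edgeGraph (Finset.univ.filter fun e => Odd (H e)) ≤ G := by
    have := edgeGraph_mono (Finset.subset_univ (Finset.univ.filter fun e => Odd (H e)))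
    rwa [edgeGraph_univ] at this
  refine ⟨p.mapLe hle, fun e => ?_⟩
  rw [walkMult, Walk.edges_mapLe_eq_edges]
  by_cases he : (e : Sym2 V) ∈ p.edges
  · have h1 : List.count (e : Sym2 V) p.edges ≤ 1 :=
      List.nodup_iff_count_le_one.1 hp.isTrail.edges_nodup _
    have h2 := p.edges_subset_edgeSet he
    obtain ⟨a, b, -, hs⟩ := exists_ends e
    rw [hs, SimpleGraph.mem_edgeSet, edgeGraph_adj] at h2
    obtain ⟨f, hf, hfs⟩ := h2
    have : f = e := Subtype.ext (hfs.trans hs.symm)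
    rw [this, Finset.mem_filter] at hf
    have := hf.2.pos
    omega
  · rw [List.count_eq_zero_of_not_mem he]
    exact Nat.zero_le _

lemma mem_support_of_walkMult_ne_zero {s t : V} {w : G.Walk s t} {e : G.edgeSet}
    (he : walkMult w e ≠ 0) {a : V} (ha : a ∈ (e : Sym2 V)) : a ∈ w.support := by
  have h : (e : Sym2 V) ∈ w.edges := by
    by_contra h
    exact he (List.count_eq_zero_of_not_mem h)
  exact Walk.mem_support_of_mem_edges h ha

lemma sum_tsub_parity {H M : G.edgeSet → ℕ} (hle : ∀ e, M e ≤ H e) {T T' : Finset V}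
    (hH : ∀ v, v ∈ T ↔ Odd (∑ e ∈ cut G {v}, H e))
    (hM : ∀ v, v ∈ T' ↔ Odd (∑ e ∈ cut G {v}, M e)) (v : V) :
    v ∈ symmDiff T T' ↔ Odd (∑ e ∈ cut G {v}, (H e - M e)) := by
  have h : ∑ e ∈ cut G {v}, (H e - M e) + ∑ e ∈ cut G {v}, M e = ∑ e ∈ cut G {v}, H e := by
    rw [← Finset.sum_add_distrib]
    exact Finset.sum_congr rfl fun e _ => Nat.sub_add_cancel (hle e)
  rw [Finset.mem_symmDiff, hH, hM, ← h, Nat.odd_add, ← Nat.not_odd_iff_even]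
  tauto

/-- **Euler's theorem** for connected multigraphs: if all degrees are even except at the ends `s`,
`t`, then there is an Eulerian walk from `s` to `t`. -/
theorem exists_eulerian_walk {H : G.edgeSet → ℕ} {s t : V}
    (hH : ∀ v, v ∈ symmDiff ({s} : Finset V) {t} ↔ Odd (∑ e ∈ cut G {v}, H e))
    (hconn : (edgeGraph (edgeSupport H)).Connected) : ∃ w : G.Walk s t, walkMult w = H := by
  have := hconn.nonempty
  -- A longest walk within `H` is Eulerian: otherwise a closed detour through unused edges could be
  -- spliced in.
  let L : Set ℕ := {n | ∃ w : G.Walk s t, (∀ e, walkMult w e ≤ H e) ∧ w.length = n}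
  have hL : L.Nonempty := by
    obtain ⟨p, hp⟩ := exists_walk_le hH
    exact ⟨_, p, hp, rfl⟩
  have hLb : BddAbove L := by
    refine ⟨∑ e, H e, ?_⟩
    rintro _ ⟨w, hw, rfl⟩
    rw [← sum_walkMult]
    exact Finset.sum_le_sum fun e _ => hw e
  obtain ⟨w, hw, hlen⟩ := Nat.sSup_mem hL hLb
  refine ⟨w, ?_⟩
  by_contra hne
  obtain ⟨e₀, he₀⟩ : ∃ e, H e - walkMult w e ≠ 0 := by
    by_contra! h
    exact hne (funext fun e => le_antisymm (hw e) (Nat.sub_eq_zero_iff_le.1 (h e)))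
  have hR := sum_tsub_parity hw hH (walkMult_parity w)
  rw [symmDiff_self] at hR
  -- An unused edge touching the walk: any unused one if all vertices are visited, else one leaving
  -- the visited set.
  obtain ⟨e, a, b, hs, ha, he⟩ : ∃ (e : G.edgeSet) (a b : V),
      (e : Sym2 V) = s(a, b) ∧ a ∈ w.support ∧ H e - walkMult w e ≠ 0 := by
    by_cases huniv : w.support.toFinset = Finset.univ
    · obtain ⟨a, b, -, hs⟩ := exists_ends e₀
      refine ⟨e₀, a, b, hs, ?_, he₀⟩
      rw [← List.mem_toFinset, huniv]; exact Finset.mem_univ a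
    · obtain ⟨e, he⟩ := edgeGraph_connected_iff.1 hconn _
        ⟨s, List.mem_toFinset.2 w.start_mem_support⟩ huniv
      obtain ⟨he1, he2⟩ := Finset.mem_inter.1 he
      obtain ⟨a, b, ha, hb, hs⟩ := exists_ends_of_mem_cut he1
      refine ⟨e, a, b, hs, List.mem_toFinset.1 ha, ?_⟩
      have : walkMult w e = 0 := by
        by_contra h
        exact hb (List.mem_toFinset.2 (mem_support_of_walkMult_ne_zero h (hs ▸ Sym2.mem_mk_right a b)))
      rw [this]
      exact mem_edgeSupport.1 he2
  have hab : G.Adj a b := by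
    have := e.2
    rwa [hs] at this
  have hee : e = ⟨s(a, b), hab⟩ := Subtype.ext hs
  have hpar : ∀ v, v ∈ symmDiff ({b} : Finset V) {a} ↔ Odd (∑ f ∈ cut G {v},
      ((H f - walkMult w f) - if f = ⟨s(a, b), hab⟩ then 1 else 0)) := by
    intro v
    have h1 := sum_tsub_parity (H := fun f => H f - walkMult w f)
      (M := fun f => if f = ⟨s(a, b), hab⟩ then 1 else 0) (fun f => by
        split_ifs with hf
        · rw [hf, ← hee]; omega
        · omega) hR (T' := symmDiff {a} {b}) (fun v => by
          have h2 := symmDiff_singleton_parity (h := hab) (H := fun _ => 0) (t := b)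
            (fun x => by simp) v
          simpa using h2) v
    rw [bot_symmDiff, symmDiff_comm] at h1
    exact h1
  -- The unused degrees are all even, so without the edge `ab` exactly `a` and `b` become odd; the
  -- walk back from `b` to `a` closes the detour.
  obtain ⟨p, hp⟩ := exists_walk_le hpar
  let w' := (w.takeUntil a ha).append ((Walk.cons hab p).append (w.dropUntil a ha))
  have hw' : ∀ f, walkMult w' f = walkMult w f + walkMult p f
      + if f = ⟨s(a, b), hab⟩ then 1 else 0 := by
    intro f
    have h1 : walkMult w f = walkMult (w.takeUntil a ha) f + walkMult (w.dropUntil a ha) f := by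
      rw [← walkMult_append, Walk.take_spec]
    rw [walkMult_append, walkMult_append, walkMult_cons, h1]
    ring
  have hw'L : w'.length ∈ L := by
    refine ⟨w', fun f => ?_, rfl⟩
    rw [hw']
    have h1 := hp f
    have h2 := hw f
    split_ifs at h1 ⊢ with hf
    · rw [hf, ← hee] at h1 h2 ⊢; omega
    · omega
  have h1 := le_csSup hLb hw'L
  rw [← hlen, ← sum_walkMult, ← sum_walkMult] at h1
  simp only [hw', Finset.sum_add_distrib, Finset.sum_ite_eq', Finset.mem_univ, if_true] at h1
  omega

lemma mem_support_of_connected {s t : V} {w : G.Walk s t}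
    (hconn : (edgeGraph (edgeSupport (walkMult w))).Connected) (v : V) : v ∈ w.support := by
  have := hconn.nonempty
  by_cases h : ({v} : Finset V) = Finset.univ
  · have : s ∈ ({v} : Finset V) := h ▸ Finset.mem_univ s
    rw [← Finset.mem_singleton.1 this]
    exact w.start_mem_support
  · obtain ⟨e, he⟩ := edgeGraph_connected_iff.1 hconn {v} ⟨v, Finset.mem_singleton_self v⟩ h
    obtain ⟨he1, he2⟩ := Finset.mem_inter.1 he
    exact mem_support_of_walkMult_ne_zero (mem_edgeSupport.1 he2) (mem_cut_singleton.1 he1)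

lemma mem_iff_of_walkMult_cut {s t : V} (w : G.Walk s t) {W : Finset V}
    (hW : ∀ e ∈ cut G W, walkMult w e = 0) : ∀ v ∈ w.support, (v ∈ W ↔ s ∈ W) := by
  induction w with
  | nil => intro v hv; simp at hv; rw [hv]
  | @cons a b d h p ih =>
    intro v hv
    have h1 : ¬ (⟨s(a, b), h⟩ : G.edgeSet) ∈ cut G W := fun h1 => by
      have := hW _ h1
      rw [walkMult_cons, if_pos rfl] at this
      omega
    rw [mem_cut rfl, not_not] at h1
    rw [Walk.support_cons, List.mem_cons] at hv
    rcases hv with rfl | hv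
    · exact Iff.rfl
    · rw [h1]
      refine ih (fun e he => ?_) v hv
      have := hW e he
      rw [walkMult_cons] at this
      omega

/-- A spanning walk contains a tour with the same ends. -/
lemma exists_tour_le_walkMult {s t : V} (w : G.Walk s t) (hw : ∀ v, v ∈ w.support) :
    ∃ K, IsTTour G (symmDiff {s} {t}) K ∧ ∀ e, K e ≤ walkMult w e := by
  have : Nonempty V := ⟨s⟩
  -- Positive multiplicities are reduced to 1 or 2 with the same parity, preserving support and odd
  -- vertices.
  let K : G.edgeSet → ℕ := fun e => if walkMult w e = 0 then 0 else 2 - walkMult w e % 2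
  have hpar : ∀ e, Odd (K e) ↔ Odd (walkMult w e) := by
    intro e
    simp only [K, Nat.odd_iff]
    by_cases h : walkMult w e = 0
    · simp [h]
    · rw [if_neg h]; omega
  have hsupp : edgeSupport K = edgeSupport (walkMult w) := by
    ext e
    simp only [mem_edgeSupport, K]
    by_cases h : walkMult w e = 0
    · simp [h]
    · rw [if_neg h]; omega
  refine ⟨K, ⟨fun e => ?_, fun v => ?_, ?_⟩, fun e => ?_⟩
  · simp only [K]; split_ifs <;> omega
  · rw [walkMult_parity w, Finset.odd_sum_iff_odd_card_odd, Finset.odd_sum_iff_odd_card_odd]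
    simp only [hpar]
  · rw [← edgeGraph_edgeSupport, edgeGraph_connected_iff, hsupp]
    intro W ⟨a, ha⟩ hW
    by_contra h
    refine hW (Finset.eq_univ_iff_forall.2 fun b => ?_)
    have h1 := mem_iff_of_walkMult_cut w (W := W) (fun e he => by
      by_contra h2
      exact h ⟨e, Finset.mem_inter.2 ⟨he, mem_edgeSupport.2 h2⟩⟩)
    exact (h1 b (hw b)).2 ((h1 a (hw a)).1 ha)
  · simp only [K]; split_ifs <;> omega

/-! ### Lengths of walks and metric shortcuts -/

lemma multiLength_mono {c : G.edgeSet → ℝ} (hc : ∀ e, 0 ≤ c e) {H K : G.edgeSet → ℕ}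
    (h : ∀ e, H e ≤ K e) : multiLength c H ≤ multiLength c K :=
  Finset.sum_le_sum fun e _ => mul_le_mul_of_nonneg_left (by exact_mod_cast h e) (hc e)

lemma multiLength_cons (c : G.edgeSet → ℝ) {u v t : V} (h : G.Adj u v) (p : G.Walk v t) :
    multiLength c (walkMult (Walk.cons h p)) = c ⟨s(u, v), h⟩ + multiLength c (walkMult p) := by
  simp only [multiLength, walkMult_cons]
  push_cast
  simp only [mul_add, Finset.sum_add_distrib, mul_ite, mul_one, mul_zero, Finset.sum_ite_eq',
    Finset.mem_univ, if_true]
  ring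

/-- The distance of two vertices of a complete graph. -/
def edgeDist (c : G.edgeSet → ℝ) (u v : V) : ℝ := if h : G.Adj u v then c ⟨s(u, v), h⟩ else 0

lemma edgeDist_of_adj (c : G.edgeSet → ℝ) {u v : V} (h : G.Adj u v) :
    edgeDist c u v = c ⟨s(u, v), h⟩ := dif_pos h

lemma edgeDist_self (c : G.edgeSet → ℝ) (u : V) : edgeDist c u u = 0 :=
  dif_neg (G.irrefl)

lemma edgeDist_nonneg {c : G.edgeSet → ℝ} (hc : ∀ e, 0 ≤ c e) (u v : V) : 0 ≤ edgeDist c u v := by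
  unfold edgeDist
  split_ifs
  exacts [hc _, le_rfl]

lemma edgeDist_triangle {c : G.edgeSet → ℝ} (hc : ∀ e, 0 ≤ c e) (hG : ∀ u v, u ≠ v → G.Adj u v)
    (htri : TriangleInequality c) (u v w : V) :
    edgeDist c u w ≤ edgeDist c u v + edgeDist c v w := by
  by_cases huw : u = w
  · subst huw
    rw [edgeDist_self]
    exact add_nonneg (edgeDist_nonneg hc _ _) (edgeDist_nonneg hc _ _)
  by_cases huv : u = v
  · subst huv; rw [edgeDist_self, zero_add]
  by_cases hvw : v = w
  · subst hvw; rw [edgeDist_self, add_zero]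
  rw [edgeDist_of_adj c (hG _ _ huw), edgeDist_of_adj c (hG _ _ huv),
    edgeDist_of_adj c (hG _ _ hvw)]
  exact htri u v w _ _ _

/-- Shortcutting the walk that goes from `u` directly to `v` and then follows `w`, avoiding the
already visited vertices `S`. -/
lemma exists_shortcut {c : G.edgeSet → ℝ} (hc : ∀ e, 0 ≤ c e) (hG : ∀ u v, u ≠ v → G.Adj u v)
    (htri : TriangleInequality c) {v t : V} (w : G.Walk v t) :
    ∀ (u : V) (S : Finset V), u ∈ S → t ∉ S → ∃ (p : G.Walk u t) (l : List V),
      p.support = u :: l ∧ l.Sublist w.support ∧ l.Nodup ∧ (∀ x ∈ l, x ∉ S) ∧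
      (∀ x ∈ w.support, x ∉ S → x ∈ l) ∧
      multiLength c (walkMult p) ≤ edgeDist c u v + multiLength c (walkMult w) := by
  induction w with
  | @nil t =>
    intro u S hu ht
    have hut : u ≠ t := fun h => ht (h ▸ hu)
    refine ⟨Walk.cons (hG u t hut) Walk.nil, [t], by simp, by simp, by simp, by simpa using ht,
      by simp, ?_⟩
    rw [multiLength_cons, edgeDist_of_adj c (hG u t hut)]
  | @cons v v' t h w ih =>
    intro u S hu ht
    rw [multiLength_cons, ← edgeDist_of_adj c h]
    -- A vertex already visited is skipped, and so is an early occurrence of `t`, which must be kept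
    -- for the end.
    by_cases hv : v ∈ S ∨ v = t
    · obtain ⟨p, l, h1, h2, h3, h4, h5, h6⟩ := ih u S hu ht
      refine ⟨p, l, h1, ?_, h3, h4, fun x hx hxS => ?_, ?_⟩
      · rw [Walk.support_cons]; exact h2.cons _
      · rw [Walk.support_cons, List.mem_cons] at hx
        rcases hx with rfl | hx
        · rcases hv with hv | rfl
          · exact absurd hv hxS
          · exact h5 _ w.end_mem_support hxS
        · exact h5 x hx hxS
      · linarith [edgeDist_triangle hc hG htri u v v']
    · push Not at hv
      obtain ⟨p, l, h1, h2, h3, h4, h5, h6⟩ := ih v (insert v S) (Finset.mem_insert_self _ _)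
        (by simp [ht, hv.2.symm])
      have huv : u ≠ v := fun h => hv.1 (h ▸ hu)
      refine ⟨Walk.cons (hG u v huv) p, v :: l, ?_, ?_, ?_, ?_, fun x hx hxS => ?_, ?_⟩
      · rw [Walk.support_cons, h1]
      · rw [Walk.support_cons]; exact h2.cons_cons _
      · exact List.nodup_cons.2 ⟨fun h => h4 v h (Finset.mem_insert_self _ _), h3⟩
      · intro x hx
        rcases List.mem_cons.1 hx with rfl | hx
        · exact hv.1
        · exact fun h => h4 x hx (Finset.mem_insert_of_mem h)
      · by_cases hxv : x = v
        · exact hxv ▸ List.mem_cons_self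
        · rw [Walk.support_cons, List.mem_cons] at hx
          refine List.mem_cons_of_mem _ (h5 x (hx.resolve_left hxv) ?_)
          simp [hxv, hxS]
      · rw [multiLength_cons, edgeDist_of_adj c (hG u v huv)]
        linarith

/-- A spanning walk in a metric complete graph can be shortcut to a Hamiltonian path. -/
theorem exists_hamiltonian_shortcut {c : G.edgeSet → ℝ} (hc : ∀ e, 0 ≤ c e)
    (hG : ∀ u v, u ≠ v → G.Adj u v) (htri : TriangleInequality c) {s t : V} (hst : s ≠ t)
    (w : G.Walk s t) (hw : ∀ v, v ∈ w.support) :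
    ∃ p : G.Walk s t, p.IsHamiltonian ∧ p.support.Sublist w.support ∧
      multiLength c (walkMult p) ≤ multiLength c (walkMult w) := by
  cases w with
  | nil => exact absurd rfl hst
  | @cons _ v _ h w =>
    obtain ⟨p, l, h1, h2, h3, h4, h5, h6⟩ := exists_shortcut hc hG htri w s {s}
      (Finset.mem_singleton_self s) (by simpa using hst.symm)
    refine ⟨p, fun a => ?_, ?_, ?_⟩
    · have hnodup : p.support.Nodup := by
        rw [h1]
        exact List.nodup_cons.2 ⟨fun h => h4 s h (Finset.mem_singleton_self s), h3⟩
      refine List.count_eq_one_of_mem hnodup ?_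
      rw [h1]
      have ha := hw a
      rw [Walk.support_cons, List.mem_cons] at ha
      by_cases has : a = s
      · exact has ▸ List.mem_cons_self
      · exact List.mem_cons_of_mem _ (h5 a (ha.resolve_left has) (by simpa using has))
    · rw [h1, Walk.support_cons]; exact h2.cons_cons _
    · rwa [multiLength_cons, ← edgeDist_of_adj c h]

end TTour

theorem theorem3 {V : Type*} [Fintype V] [DecidableEq V] (G : SimpleGraph V) [DecidableRel G.Adj]
    (hG : G.Connected) (c : G.edgeSet → ℝ) (hc : ∀ e, 0 ≤ c e) :
    -- the expected length of a parity correction, and the guarantee for shortest `T`-tours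
    (∀ T : Finset V, Even T.card →
      (∀ (x : G.edgeSet → ℝ) (lam : Finset G.edgeSet → ℝ),
        TTour.IsOptimal G T c x → TTour.IsTreeDistribution G x lam →
        TTour.expectation lam (fun F => TTour.tau G (symmDiff (TTour.oddVerts G F) T) c)
          ≤ 3 / 5 * TTour.dot c x) ∧
      (∃ H, TTour.IsBestOfManyOutput G T c H) ∧
      ∀ H, TTour.IsBestOfManyOutput G T c H →
        TTour.IsTTour G T H ∧
        (∀ x, TTour.IsOptimal G T c x →
          TTour.multiLength c H ≤ 8 / 5 * TTour.dot c x) ∧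
        ∀ K, TTour.IsTTour G T K →
          TTour.multiLength c H ≤ 8 / 5 * TTour.multiLength c K) ∧
    -- the guarantee for the path version, `T = {s, t}` (`T = ∅` if `s = t`)
    ∀ (s t : V) (H : G.edgeSet → ℕ),
      TTour.IsBestOfManyOutput G (symmDiff {s} {t}) c H →
      ∃ w : G.Walk s t, TTour.walkMult w = H ∧ (∀ v, v ∈ w.support) ∧
        (∀ w' : G.Walk s t, (∀ v, v ∈ w'.support) →
          TTour.multiLength c (TTour.walkMult w)
            ≤ 8 / 5 * TTour.multiLength c (TTour.walkMult w')) ∧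
        -- the metric version with Hamiltonian paths
        (G = ⊤ → TTour.TriangleInequality c → s ≠ t →
          ∃ p : G.Walk s t, p.IsHamiltonian ∧ p.support.Sublist w.support ∧
            ∀ q : G.Walk s t, q.IsHamiltonian →
              TTour.multiLength c (TTour.walkMult p)
                ≤ 8 / 5 * TTour.multiLength c (TTour.walkMult q)) := by
  have := hG.nonempty
  refine ⟨fun T hT => ⟨fun x lam hx hlam => TTour.expectation_tau_le hc hT hx.1 hlam,
    TTour.exists_output hG hT c, fun H hH => hH.isTTour_and_le hc hT⟩, fun s t H hH => ?_⟩
  have heven : Even (symmDiff ({s} : Finset V) {t}).card := by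
    rw [← Nat.not_odd_iff_even, TTour.odd_card_symmDiff]
    simp
  obtain ⟨hHT, -, hle⟩ := hH.isTTour_and_le hc heven
  obtain ⟨w, rfl⟩ := TTour.exists_eulerian_walk hHT.parity hHT.connected_edgeGraph
  have hspan := TTour.mem_support_of_connected hHT.connected_edgeGraph
  have hbound : ∀ w' : G.Walk s t, (∀ v, v ∈ w'.support) →
      TTour.multiLength c (TTour.walkMult w) ≤ 8 / 5 * TTour.multiLength c (TTour.walkMult w') := by
    intro w' hw'
    -- A competing walk may use an edge more than twice, so it is first reduced to a tour.
    obtain ⟨K, hK, hKle⟩ := TTour.exists_tour_le_walkMult w' hw'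
    have h1 := hle K hK
    have h2 := TTour.multiLength_mono hc hKle
    linarith
  refine ⟨w, rfl, hspan, hbound, fun htop htri hst => ?_⟩
  have hadj : ∀ u v, u ≠ v → G.Adj u v := by
    intro u v huv
    rw [htop]; exact huv
  obtain ⟨p, hp, hsub, hplen⟩ := TTour.exists_hamiltonian_shortcut hc hadj htri hst w hspan
  exact ⟨p, hp, hsub, fun q hq => hplen.trans (hbound q hq.mem_support)⟩
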